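/- A 2-tangle is an unoriented tangle with four fixed ends (two upper, two lower; closed components allowed), given by a diagram, and considered up to isotopy fixing the ends, i.e. up to planar isotopy and the Reidemeister moves. A $5$-move replaces two parallel strands by a twist of five crossings ($\pm 5$ half twists); two tangles are $5$-move equivalent if they are related by a finite sequence of isotopies, $5$-moves and inverse $5$-moves. Let $[0]$ be the tangle of two horizontal arcs, $[\frac10]=[\infty]$ the tangle of two vertical strands, and $[1]$ (resp. $[-1]$) the tangle with a single crossing whose overstrand has positive (resp. negative) slope. Write $S+T$ for placing $S$ to the left of $T$ and joining the adjacent ends, and $S/T$ for stacking $S$ on top of $T$ and joining the adjacent ends. A tangle is rational if it is isotopic to one obtained from $[0]$ or $[\frac10]$ by adding crossings $[\pm1]$ one at a time on the right, left, top or bottom. In Conway's notation, $[\pm2]=[\pm1]+[\pm1]$, $[\pm\frac12]=[\pm1]/[\pm1]$, $[\pm\frac32]=[\pm1]+[\pm\frac12]$ (equal signs throughout), $[\frac52]=[2]+[\frac12]$ and $[\frac25]=[\frac12]/[2]$. **Lemma.** Every rational tangle is $5$-move equivalent to one of the twelve 2-tangles $$[\tfrac10],\ [0],\ [-1],\ [1],\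 [-2],\ [2],\ [\tfrac25],\ [\tfrac52],\ [\tfrac32],\ [-\tfrac32],\ [\tfrac12],\ [-\tfrac12].$$ Furthermore, these twelve tangles lie in pairwise distinct $5$-move equivalence classes. -/

import Mathlib

/-! Unoriented tangle diagrams in a strip, cut by horizontal lines into elementary slices, up to
planar isotopy and the Reidemeister moves. -/

namespace TangleDiagram

/-- The elementary pieces of a diagram. `cap` is a local maximum `∩`, `cup` a local minimum `∪`.
In the crossing `pos` the overstrand has positive slope (it joins the upper right to the lower
left end), in the crossing `neg` it has negative slope. -/
inductive Piece
  | cap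
  | cup
  | pos
  | neg
  deriving DecidableEq

/-- The number of strands that enter a piece from above. -/
def Piece.dom : Piece → ℕ
  | .cap => 0
  | .cup => 2
  | .pos => 2
  | .neg => 2

/-- The number of strands that leave a piece below. -/
def Piece.cod : Piece → ℕ
  | .cap => 2
  | .cup => 0
  | .pos => 2
  | .neg => 2

/-- A stack of slices, read from top to bottom. The slice `(i, g)` consists of `i` vertical
strands, then the piece `g`, then vertical strands up to the total width. -/
abbrev Word := List (ℕ × Piece)

/-- `Typed w n m`: the word `w` is the diagram of a tangle with `n` upper and `m` lower ends. -/
def Typed : Word → ℕ → ℕ → Prop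
  | [], n, m => n = m
  | (i, g) :: w, n, m => i + g.dom ≤ n ∧ Typed w (n - g.dom + g.cod) m

/-- Put `k` vertical strands to the left of a diagram. -/
def shift (k : ℕ) (w : Word) : Word := w.map fun s => (k + s.1, s.2)

theorem Typed.append {u v : Word} {n m l : ℕ} (hu : Typed u n m) (hv : Typed v m l) :
    Typed (u ++ v) n l := by
  induction u generalizing n with
  | nil => cases hu; exact hv
  | cons s u ih => exact ⟨hu.1, ih hu.2⟩

theorem Typed.add_right {w : Word} {n m : ℕ} (h : Typed w n m) (k : ℕ) :
    Typed w (n + k) (m + k) := by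
  induction w generalizing n with
  | nil => exact congrArg (· + k) h
  | cons s w ih =>
    obtain ⟨h1, h2⟩ := h
    refine ⟨by omega, ?_⟩
    have := ih h2
    rwa [show n - s.2.dom + s.2.cod + k = n + k - s.2.dom + s.2.cod by omega] at this

theorem Typed.shift {w : Word} {n m : ℕ} (h : Typed w n m) (k : ℕ) :
    Typed (shift k w) (k + n) (k + m) := by
  induction w generalizing n with
  | nil => exact congrArg (k + ·) h
  | cons s w ih =>
    obtain ⟨h1, h2⟩ := h
    refine ⟨?_, ?_⟩
    · show k + s.1 + s.2.dom ≤ k + n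
      omega
    · have := ih h2
      rwa [show k + (n - s.2.dom + s.2.cod) = k + n - s.2.dom + s.2.cod by omega] at this

/-- The local moves that generate isotopy of tangle diagrams with fixed ends. -/
inductive LocalIsotopy : Word → Word → Prop
  /-- Planar isotopy: pieces that lie side by side can change their heights. -/
  | exchange (i k : ℕ) (g h : Piece) :
      LocalIsotopy [(i, g), (i + g.cod + k, h)] [(i + g.dom + k, h), (i, g)]
  /-- Planar isotopy: a maximum cancels against an adjacent minimum. -/
  | zigzag_right (i : ℕ) : LocalIsotopy [(i, .cap), (i + 1, .cup)] []
  | zigzag_left (i : ℕ) : LocalIsotopy [(i + 1, .cap), (i, .cup)] []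
  /-- Planar isotopy: a crossing is turned around a maximum or a minimum. -/
  | slide_cap_pos (i : ℕ) :
      LocalIsotopy [(i, .cap), (i + 1, .pos)] [(i + 1, .cap), (i, .neg)]
  | slide_cap_neg (i : ℕ) :
      LocalIsotopy [(i, .cap), (i + 1, .neg)] [(i + 1, .cap), (i, .pos)]
  | slide_cup_pos (i : ℕ) :
      LocalIsotopy [(i + 1, .pos), (i, .cup)] [(i, .neg), (i + 1, .cup)]
  | slide_cup_neg (i : ℕ) :
      LocalIsotopy [(i + 1, .neg), (i, .cup)] [(i, .pos), (i + 1, .cup)]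
  /-- First Reidemeister move. -/
  | r1_cap_pos (i : ℕ) : LocalIsotopy [(i, .cap), (i, .pos)] [(i, .cap)]
  | r1_cap_neg (i : ℕ) : LocalIsotopy [(i, .cap), (i, .neg)] [(i, .cap)]
  | r1_cup_pos (i : ℕ) : LocalIsotopy [(i, .pos), (i, .cup)] [(i, .cup)]
  | r1_cup_neg (i : ℕ) : LocalIsotopy [(i, .neg), (i, .cup)] [(i, .cup)]
  /-- Second Reidemeister move. -/
  | r2_pos_neg (i : ℕ) : LocalIsotopy [(i, .pos), (i, .neg)] []
  | r2_neg_pos (i : ℕ) : LocalIsotopy [(i, .neg), (i, .pos)] []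
  /-- Third Reidemeister move. -/
  | r3 (i : ℕ) :
      LocalIsotopy [(i, .pos), (i + 1, .pos), (i, .pos)] [(i + 1, .pos), (i, .pos), (i + 1, .pos)]

/-- The `±5`-move: two parallel strands are replaced by five half twists of either handedness.
(A pair of parallel arcs in any other position is made vertical by a planar isotopy.) -/
inductive LocalFiveMove : Word → Word → Prop
  | pos (i : ℕ) : LocalFiveMove [] (List.replicate 5 (i, .pos))
  | neg (i : ℕ) : LocalFiveMove [] (List.replicate 5 (i, .neg))

/-- Replacement of one part of a diagram according to a local rule. -/
def InContext (R : Word → Word → Prop) (w w' : Word) : Prop :=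
  ∃ u v a b : Word, R a b ∧ w = u ++ a ++ v ∧ w' = u ++ b ++ v

end TangleDiagram

open TangleDiagram

/-- Diagrams of tangles with `n` upper and `m` lower ends. Closed components are allowed. -/
def Tangle (n m : ℕ) : Type := {w : Word // Typed w n m}

namespace Tangle

/-- Isotopy of tangles, with fixed ends. -/
def Isotopic {n m : ℕ} : Tangle n m → Tangle n m → Prop :=
  Relation.EqvGen fun S T => InContext LocalIsotopy S.1 T.1

/-- `5`-move equivalence of tangles: a finite sequence of isotopies, `±5`-moves and their
inverses. -/
def FiveMoveEquiv {n m : ℕ} : Tangle n m → Tangle n m → Prop :=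
  Relation.EqvGen fun S T => InContext LocalIsotopy S.1 T.1 ∨ InContext LocalFiveMove S.1 T.1

/-- The tangle `[∞] = [1/0]`, two vertical strands. -/
def infty : Tangle 2 2 := ⟨[], rfl⟩

/-- The tangle `[0]`, two horizontal arcs. -/
def zero : Tangle 2 2 := ⟨[(0, .cup), (0, .cap)], by simp [Typed, Piece.dom, Piece.cod]⟩

/-- The tangle `[1]`. -/
def one : Tangle 2 2 := ⟨[(0, .pos)], by simp [Typed, Piece.dom, Piece.cod]⟩

/-- The tangle `[-1]`. -/
def negOne : Tangle 2 2 := ⟨[(0, .neg)], by simp [Typed, Piece.dom, Piece.cod]⟩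

/-- Vertical composition: `S` on top of `T`. -/
def stack (S T : Tangle 2 2) : Tangle 2 2 := ⟨S.1 ++ T.1, S.2.append T.2⟩

/-- Horizontal composition: `S` to the left of `T`, the right ends of `S` joined to the
left ends of `T`. -/
def beside (S T : Tangle 2 2) : Tangle 2 2 :=
  ⟨(1, .cap) :: (S.1 ++ shift 2 T.1 ++ [(1, .cup)]),
    by simp [Piece.dom],
    ((S.2.add_right 2).append (T.2.shift 2)).append
      (by simp [Typed, Piece.dom, Piece.cod])⟩

/-- Diagrams built from `[0]` or `[∞]` by twisting adjacent ends, that is, by adding crossings one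
at a time on the right, on the left, at the top or at the bottom. -/
inductive RationalDiagram : Tangle 2 2 → Prop
  | zero : RationalDiagram zero
  | infty : RationalDiagram infty
  | right {T c : Tangle 2 2} (hT : RationalDiagram T) (hc : c = one ∨ c = negOne) :
      RationalDiagram (T.beside c)
  | left {T c : Tangle 2 2} (hT : RationalDiagram T) (hc : c = one ∨ c = negOne) :
      RationalDiagram (c.beside T)
  | bottom {T c : Tangle 2 2} (hT : RationalDiagram T) (hc : c = one ∨ c = negOne) :
      RationalDiagram (T.stack c)
  | top {T c : Tangle 2 2} (hT : RationalDiagram T) (hc : c = one ∨ c = negOne) :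
      RationalDiagram (c.stack T)

/-- A rational tangle is a 2-tangle isotopic to one with a rational diagram. -/
def IsRational (T : Tangle 2 2) : Prop := ∃ D, RationalDiagram D ∧ Isotopic T D

/-- The tangle `[2]`. -/
def two : Tangle 2 2 := one.beside one

/-- The tangle `[-2]`. -/
def negTwo : Tangle 2 2 := negOne.beside negOne

/-- The tangle `[1/2]`. -/
def half : Tangle 2 2 := one.stack one

/-- The tangle `[-1/2]`. -/
def negHalf : Tangle 2 2 := negOne.stack negOne

/-- The tangle `[3/2] = [1 + 1/2]`. -/
def threeHalves : Tangle 2 2 := one.beside half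

/-- The tangle `[-3/2] = [-1 - 1/2]`. -/
def negThreeHalves : Tangle 2 2 := negOne.beside negHalf

/-- The tangle `[5/2] = [2 + 1/2]`. -/
def fiveHalves : Tangle 2 2 := two.beside half

/-- The tangle `[2/5] = [1 / (2 + 1/2)]`; stacking adds the reciprocals of the fractions. -/
def twoFifths : Tangle 2 2 := half.stack two

/-- The twelve basic tangles `[1/0], [0], [-1], [1], [-2], [2], [2/5], [5/2], [3/2], [-3/2],
[1/2], [-1/2]`. -/
def basic : Fin 12 → Tangle 2 2 :=
  ![infty, zero, negOne, one, negTwo, two, twoFifths, fiveHalves, threeHalves, negThreeHalves,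
    half, negHalf]

end Tangle

/-! Modulo five, and up to a common sign, the fraction of a rational tangle is a nonzero vector of
`𝔽₅²` up to sign, and there are (25 - 1) / 2 = 12 of these. The twelve basic tangles represent each
of them once, so the claim is that `5`-moves identify exactly the rational tangles with the same
vector.

For distinctness, the Kauffman bracket is taken at `A ^ 4 = -1`, where a closed loop has value zero.
The hook `e` (a minimum above a maximum) then satisfies `e * e = 0`, and a crossing is `x + y e`.
Its fifth power is `x ^ 5 + 5 x ^ 4 y e`, which is a scalar in characteristic five. So isotopy and
`5`-moves change the bracket `p [∞] + q [0]` of a 2-tangle only by powers of `A`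
(`bracket_fiveMoveEquiv`). For the basic tangle of fraction `N / D`, the pair `(p, q)` is `(A ^ 2 N,
D)` up to a power of `A`, and `basicBracket_distinct` compares the twelve pairs.

For completeness, turn one end of a 2-tangle to the opposite side. The two ways of adding crossings
that are still visible become multiplication by the two generators of the three-strand braid group,
by `bend_beside` and its variants. The third Reidemeister move gives the braid relation and the
`5`-move gives order five. From these and the values at `[0]` and `[∞]` it follows by pure algebra
that twelve points are permuted (`TwistPair.fst_orbit`, `TwistPair.snd_orbit`). This applies to
right and bottom, left and bottom, and right and top. Opposite sides commute, which forces the three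
orbits to coincide (`orbit_eq_of_fst_comm`, `orbit_eq_of_snd_comm`). The common orbit contains `[0]`
and `[∞]` and is closed under all four ways of adding a crossing. -/

namespace TangleDiagram

/-! ### An operator form of the Kauffman bracket at an eighth root of unity -/

section Bracket

variable {R : Type*} [CommRing R]

/-- Functions on the states of the strands; the states of the finitely many strands of a diagram
are padded to an infinite sequence. -/
abbrev StateFun (R : Type*) := Stream' Bool → R

/-- Put one vertical strand to the left of an operator. -/
def liftEnd : Module.End R (StateFun R) →ₐ[R] Module.End R (StateFun R) where
  toFun φ :=
    { toFun := fun f s => φ (fun t => f (Stream'.cons s.head t)) s.tail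
      map_add' := fun f g => by
        ext s
        exact congrFun (map_add φ (fun t => f (Stream'.cons s.head t))
          (fun t => g (Stream'.cons s.head t))) s.tail
      map_smul' := fun c f => by
        ext s
        exact congrFun (map_smul φ c (fun t => f (Stream'.cons s.head t))) s.tail }
  map_one' := by
    ext f s
    exact congrArg f (Stream'.eta s)
  map_mul' φ ψ := rfl
  map_zero' := rfl
  map_add' φ ψ := rfl
  commutes' c := by
    ext f s
    exact congrArg (fun t => c * f t) (Stream'.eta s)

/-- The bilinear form on the states of two adjacent strands. -/
def pairing (A : R) : Bool → Bool → R
  | false, true => A ^ 3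
  | true, false => -A
  | _, _ => 0

/-- The operator of a maximum. -/
def capEnd (A : R) : Module.End R (StateFun R) where
  toFun f s := A ^ 3 * f (Stream'.cons false (Stream'.cons true s)) +
    -A * f (Stream'.cons true (Stream'.cons false s))
  map_add' f g := by ext s; simp only [Pi.add_apply]; ring
  map_smul' c f := by
    ext s; simp only [Pi.smul_apply, smul_eq_mul, RingHom.id_apply]; ring

/-- The operator of a minimum. -/
def cupEnd (A : R) : Module.End R (StateFun R) where
  toFun f s := pairing A s.head s.tail.head * f s.tail.tail
  map_add' f g := by ext s; simp only [Pi.add_apply]; ring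
  map_smul' c f := by
    ext s; simp only [Pi.smul_apply, smul_eq_mul, RingHom.id_apply]; ring

/-- The operator of a piece, by Kauffman's skein rule at an eighth root of unity `A`. -/
def pieceEnd (A : R) : Piece → Module.End R (StateFun R)
  | .cap => capEnd A
  | .cup => cupEnd A
  | .pos => A • 1 + (-A ^ 3) • (cupEnd A * capEnd A)
  | .neg => (-A ^ 3) • 1 + A • (cupEnd A * capEnd A)

/-- Put `i` vertical strands to the left of an operator. -/
def liftIter : ℕ → (Module.End R (StateFun R) →ₐ[R] Module.End R (StateFun R))
  | 0 => AlgHom.id R _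
  | i + 1 => (liftIter i).comp liftEnd

theorem liftIter_zero (φ : Module.End R (StateFun R)) : liftIter 0 φ = φ := rfl

theorem liftIter_succ (i : ℕ) (φ : Module.End R (StateFun R)) :
    liftIter (i + 1) φ = liftIter i (liftEnd φ) := rfl

theorem liftIter_add (i j : ℕ) (φ : Module.End R (StateFun R)) :
    liftIter (i + j) φ = liftIter i (liftIter j φ) := by
  induction j generalizing φ with
  | zero => rfl
  | succ j ih => exact ih _

/-- The operator of a diagram, a form of the Kauffman bracket. -/
def bracket (A : R) (w : Word) : Module.End R (StateFun R) :=
  (w.map fun s => liftIter s.1 (pieceEnd A s.2)).prod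

@[simp] theorem bracket_nil (A : R) : bracket A [] = 1 := rfl

@[simp] theorem bracket_cons (A : R) (s : ℕ × Piece) (w : Word) :
    bracket A (s :: w) = liftIter s.1 (pieceEnd A s.2) * bracket A w := by
  simp [bracket]

theorem bracket_append (A : R) (u v : Word) :
    bracket A (u ++ v) = bracket A u * bracket A v := by
  simp [bracket]

theorem bracket_shift (A : R) (k : ℕ) (w : Word) :
    bracket A (shift k w) = liftIter k (bracket A w) := by
  induction w with
  | nil => exact (map_one _).symm
  | cons s w ih =>
    have : shift k (s :: w) = (k + s.1, s.2) :: shift k w := rfl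
    rw [this, bracket_cons, bracket_cons, map_mul, ih, liftIter_add]

/-- The maximum touches only the leading coordinates and `φ` only the tail behind them, so the
exchange of heights is just linearity of `φ`. -/
theorem cap_exchange (A : R) (φ : Module.End R (StateFun R)) :
    capEnd A * liftEnd (liftEnd φ) = φ * capEnd A := by
  ext f s
  have : capEnd A f = A ^ 3 • (fun t => f (Stream'.cons false (Stream'.cons true t))) +
    (-A) • (fun t => f (Stream'.cons true (Stream'.cons false t))) := rfl
  rw [Module.End.mul_apply, Module.End.mul_apply, this, map_add, map_smul, map_smul]
  rfl

theorem cup_exchange (A : R) (φ : Module.End R (StateFun R)) :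
    cupEnd A * φ = liftEnd (liftEnd φ) * cupEnd A := by
  ext f s
  exact (congrFun (map_smul φ (pairing A s.head s.tail.head) f) s.tail.tail).symm

theorem hook_exchange (A : R) (φ : Module.End R (StateFun R)) :
    cupEnd A * capEnd A * liftEnd (liftEnd φ) = liftEnd (liftEnd φ) * (cupEnd A * capEnd A) := by
  rw [mul_assoc, cap_exchange, ← mul_assoc, cup_exchange, mul_assoc]

theorem piece_exchange (A : R) (φ : Module.End R (StateFun R)) (g : Piece) :
    pieceEnd A g * liftIter g.cod φ = liftIter g.dom φ * pieceEnd A g := by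
  cases g
  · exact cap_exchange A φ
  · exact cup_exchange A φ
  · have := hook_exchange A φ
    simp only [pieceEnd, Piece.cod, Piece.dom, liftIter_succ, liftIter_zero, add_mul, mul_add,
      smul_mul_assoc, mul_smul_comm, this, one_mul, mul_one]
  · have := hook_exchange A φ
    simp only [pieceEnd, Piece.cod, Piece.dom, liftIter_succ, liftIter_zero, add_mul, mul_add,
      smul_mul_assoc, mul_smul_comm, this, one_mul, mul_one]

variable {A : R}

/-- A closed loop has value `A ^ 6 + A ^ 2 = A ^ 2 (A ^ 4 + 1)`. -/
theorem cap_mul_cup_self (hA : A ^ 4 = -1) : capEnd A * cupEnd A = 0 := by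
  ext f s
  have : A ^ 3 * (A ^ 3 * f s) + -A * (-A * f s) = 0 := by
    linear_combination (A ^ 2 * f s) * hA
  exact this

/-- Straightening a zigzag costs `A ^ 3 * (-A) = -A ^ 4 = 1`; the Temperley–Lieb relations below
follow from this and its mirror image. -/
theorem cap_mul_lift_cup (hA : A ^ 4 = -1) : capEnd A * liftEnd (cupEnd A) = 1 := by
  ext f s
  change A ^ 3 * (pairing A true s.head * f (Stream'.cons false s.tail)) +
    -A * (pairing A false s.head * f (Stream'.cons true s.tail)) = f s
  conv_rhs => rw [← Stream'.eta s]
  cases s.head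
  · simp only [pairing]; linear_combination (-f (Stream'.cons false s.tail)) * hA
  · simp only [pairing]; linear_combination (-f (Stream'.cons true s.tail)) * hA

theorem lift_cap_mul_cup (hA : A ^ 4 = -1) : liftEnd (capEnd A) * cupEnd A = 1 := by
  ext f s
  change A ^ 3 * (pairing A s.head false * f (Stream'.cons true s.tail)) +
    -A * (pairing A s.head true * f (Stream'.cons false s.tail)) = f s
  conv_rhs => rw [← Stream'.eta s]
  cases s.head
  · simp only [pairing]; linear_combination (-f (Stream'.cons false s.tail)) * hA
  · simp only [pairing]; linear_combination (-f (Stream'.cons true s.tail)) * hA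

theorem hook_sq (hA : A ^ 4 = -1) : cupEnd A * capEnd A * (cupEnd A * capEnd A) = 0 := by
  rw [mul_assoc, ← mul_assoc (capEnd A), cap_mul_cup_self hA, zero_mul, mul_zero]

theorem cap_mul_lift_hook (hA : A ^ 4 = -1) :
    capEnd A * liftEnd (cupEnd A * capEnd A) = liftEnd (capEnd A) := by
  rw [map_mul, ← mul_assoc, cap_mul_lift_cup hA, one_mul]

theorem lift_cap_mul_hook (hA : A ^ 4 = -1) :
    liftEnd (capEnd A) * (cupEnd A * capEnd A) = capEnd A := by
  rw [← mul_assoc, lift_cap_mul_cup hA, one_mul]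

theorem lift_hook_mul_cup (hA : A ^ 4 = -1) :
    liftEnd (cupEnd A * capEnd A) * cupEnd A = liftEnd (cupEnd A) := by
  rw [map_mul, mul_assoc, lift_cap_mul_cup hA, mul_one]

theorem hook_mul_lift_cup (hA : A ^ 4 = -1) :
    cupEnd A * capEnd A * liftEnd (cupEnd A) = cupEnd A := by
  rw [mul_assoc, cap_mul_lift_cup hA, mul_one]

theorem hook_mul_lift_hook_mul_hook (hA : A ^ 4 = -1) :
    cupEnd A * capEnd A * (liftEnd (cupEnd A * capEnd A) * (cupEnd A * capEnd A)) =
      cupEnd A * capEnd A := by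
  rw [← mul_assoc (liftEnd _), lift_hook_mul_cup hA, ← mul_assoc, hook_mul_lift_cup hA]

theorem lift_hook_mul_hook_mul_lift_hook (hA : A ^ 4 = -1) :
    liftEnd (cupEnd A * capEnd A) * (cupEnd A * capEnd A * liftEnd (cupEnd A * capEnd A)) =
      liftEnd (cupEnd A * capEnd A) := by
  rw [mul_assoc (cupEnd A), cap_mul_lift_hook hA, ← mul_assoc, lift_hook_mul_cup hA, map_mul]

theorem skein_mul {E : Type*} [Ring E] [Algebra R E] {e : E} (he : e * e = 0) (x y x' y' : R) :
    (x • (1 : E) + y • e) * (x' • (1 : E) + y' • e) =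
      (x * x') • (1 : E) + (x * y' + y * x') • e := by
  simp only [add_mul, mul_add, smul_mul_smul_comm, one_mul, mul_one, he, smul_zero, add_zero,
    add_smul]
  abel

/-- As `e` squares to zero, the only other term of the binomial expansion is `5 x ^ 4 y e`. This is
why `5`-moves pair with characteristic five. -/
theorem skein_pow_five {E : Type*} [Ring E] [Algebra R E] (h5 : (5 : R) = 0) {e : E}
    (he : e * e = 0) (x y : R) : (x • (1 : E) + y • e) ^ 5 = x ^ 5 • (1 : E) := by
  simp only [pow_succ, pow_zero, one_mul, skein_mul he]
  have : x * x * x * x * y + (x * x * x * y + (x * x * y + (x * y + y * x) * x) * x) * x =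
      0 := by
    linear_combination (x ^ 4 * y) * h5
  rw [this, zero_smul, add_zero]

/-- The two sides can differ only in the coefficients of `e` and `f`. One side has the linear term
twice together with the cubic term from `e f e = e`, the other has it once; `h1` says that the
linear and cubic coefficients cancel. -/
theorem skein_braid {E : Type*} [Ring E] [Algebra R E] (hA : A ^ 4 = -1) {e f : E}
    (he : e * e = 0) (hf : f * f = 0) (hefe : e * (f * e) = e) (hfef : f * (e * f) = f) :
    (A • (1 : E) + (-A ^ 3) • e) * ((A • (1 : E) + (-A ^ 3) • f) * (A • (1 : E) + (-A ^ 3) • e)) =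
    (A • (1 : E) + (-A ^ 3) • f) * ((A • (1 : E) + (-A ^ 3) • e) * (A • (1 : E) + (-A ^ 3) • f)) := by
  simp only [add_mul, mul_add, smul_mul_smul_comm, one_mul, mul_one, he, hf, hefe, hfef, smul_zero,
    add_zero]
  have h1 : A * (A * -A ^ 3) + -A ^ 3 * (-A ^ 3 * -A ^ 3) = 0 := by
    linear_combination (-A ^ 5) * hA
  have key : ∀ g : E, (A * (A * -A ^ 3)) • g = -((-A ^ 3 * (-A ^ 3 * -A ^ 3)) • g) := by
    intro g
    rw [← neg_smul, eq_neg_of_add_eq_zero_left h1]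
  have h2 : A * (-A ^ 3 * A) = A * (A * -A ^ 3) := by ring
  have h3 : -A ^ 3 * (A * A) = A * (A * -A ^ 3) := by ring
  have h4 : A * (-A ^ 3 * -A ^ 3) = -A ^ 3 * (-A ^ 3 * A) := by ring
  simp only [h2, h3, h4, key]
  abel

/-- Only the first Reidemeister move contributes a factor, `A` or its inverse `-A ^ 3 = A ^ 7`. -/
theorem bracket_localIsotopy (hA : A ^ 4 = -1) {a b : Word} (h : LocalIsotopy a b) :
    ∃ k : ℕ, bracket A a = A ^ k • bracket A b := by
  have h3 : ∀ x : Module.End R (StateFun R), (-A ^ 3) • x = A ^ 7 • x := fun x => by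
    rw [show A ^ 7 = -A ^ 3 by linear_combination A ^ 3 * hA]
  have hinv :
      (A • (1 : Module.End R (StateFun R)) + (-A ^ 3) • (cupEnd A * capEnd A)) *
      ((-A ^ 3) • (1 : Module.End R (StateFun R)) + A • (cupEnd A * capEnd A)) = 1 ∧
      ((-A ^ 3) • (1 : Module.End R (StateFun R)) + A • (cupEnd A * capEnd A)) *
      (A • (1 : Module.End R (StateFun R)) + (-A ^ 3) • (cupEnd A * capEnd A)) = 1 := by
    rw [skein_mul (hook_sq hA), skein_mul (hook_sq hA),
      show A * -A ^ 3 = 1 by linear_combination -hA,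
      show -A ^ 3 * A = 1 by linear_combination -hA,
      show A * A + -A ^ 3 * -A ^ 3 = 0 by linear_combination A ^ 2 * hA,
      show -A ^ 3 * -A ^ 3 + A * A = 0 by linear_combination A ^ 2 * hA]
    simp
  cases h with
  | exchange i k g h =>
    refine ⟨0, ?_⟩
    simp only [bracket_cons, bracket_nil, mul_one, pow_zero, one_smul, liftIter_add, ← map_mul,
      piece_exchange]
  | zigzag_right i =>
    refine ⟨0, ?_⟩
    simp only [bracket_cons, bracket_nil, mul_one, pow_zero, one_smul, liftIter_succ, ← map_mul,
      pieceEnd, cap_mul_lift_cup hA, map_one]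
  | zigzag_left i =>
    refine ⟨0, ?_⟩
    simp only [bracket_cons, bracket_nil, mul_one, pow_zero, one_smul, liftIter_succ, ← map_mul,
      pieceEnd, lift_cap_mul_cup hA, map_one]
  | slide_cap_pos i =>
    refine ⟨0, ?_⟩
    simp only [bracket_cons, bracket_nil, mul_one, pow_zero, one_smul, liftIter_succ, ← map_mul,
      pieceEnd]
    simp only [map_add, map_smul, map_one, mul_add, mul_smul_comm, mul_one,
      cap_mul_lift_hook hA, lift_cap_mul_hook hA]
    rw [add_comm]
  | slide_cap_neg i =>
    refine ⟨0, ?_⟩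
    simp only [bracket_cons, bracket_nil, mul_one, pow_zero, one_smul, liftIter_succ, ← map_mul,
      pieceEnd]
    simp only [map_add, map_smul, map_one, mul_add, mul_smul_comm, mul_one,
      cap_mul_lift_hook hA, lift_cap_mul_hook hA]
    rw [add_comm]
  | slide_cup_pos i =>
    refine ⟨0, ?_⟩
    simp only [bracket_cons, bracket_nil, mul_one, pow_zero, one_smul, liftIter_succ, ← map_mul,
      pieceEnd]
    simp only [map_add, map_smul, map_one, add_mul, smul_mul_assoc, one_mul,
      hook_mul_lift_cup hA, lift_hook_mul_cup hA]
    rw [add_comm]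
  | slide_cup_neg i =>
    refine ⟨0, ?_⟩
    simp only [bracket_cons, bracket_nil, mul_one, pow_zero, one_smul, liftIter_succ, ← map_mul,
      pieceEnd]
    simp only [map_add, map_smul, map_one, add_mul, smul_mul_assoc, one_mul,
      hook_mul_lift_cup hA, lift_hook_mul_cup hA]
    rw [add_comm]
  | r1_cap_pos i =>
    refine ⟨1, ?_⟩
    simp only [bracket_cons, bracket_nil, mul_one, ← map_mul, pieceEnd, mul_add, mul_smul_comm,
      ← mul_assoc, cap_mul_cup_self hA, zero_mul, smul_zero, add_zero, map_smul, pow_one]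
  | r1_cap_neg i =>
    refine ⟨7, ?_⟩
    simp only [bracket_cons, bracket_nil, mul_one, ← map_mul, pieceEnd, mul_add, mul_smul_comm,
      ← mul_assoc, cap_mul_cup_self hA, zero_mul, smul_zero, add_zero, map_smul, h3]
  | r1_cup_pos i =>
    refine ⟨1, ?_⟩
    simp only [bracket_cons, bracket_nil, mul_one, ← map_mul, pieceEnd, add_mul, smul_mul_assoc,
      mul_assoc, one_mul, cap_mul_cup_self hA, mul_zero, smul_zero, add_zero, map_smul, pow_one]
  | r1_cup_neg i =>
    refine ⟨7, ?_⟩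
    simp only [bracket_cons, bracket_nil, mul_one, ← map_mul, pieceEnd, add_mul, smul_mul_assoc,
      mul_assoc, one_mul, cap_mul_cup_self hA, mul_zero, smul_zero, add_zero, map_smul, h3]
  | r2_pos_neg i =>
    refine ⟨0, ?_⟩
    simp only [bracket_cons, bracket_nil, mul_one, ← map_mul, pieceEnd, hinv.1, map_one,
      pow_zero, one_smul]
  | r2_neg_pos i =>
    refine ⟨0, ?_⟩
    simp only [bracket_cons, bracket_nil, mul_one, ← map_mul, pieceEnd, hinv.2, map_one,
      pow_zero, one_smul]
  | r3 i =>
    refine ⟨0, ?_⟩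
    have := skein_braid hA (hook_sq hA) (f := liftEnd (cupEnd A * capEnd A))
      (by rw [← map_mul, hook_sq hA, map_zero]) (hook_mul_lift_hook_mul_hook hA)
      (lift_hook_mul_hook_mul_lift_hook hA)
    simp only [bracket_cons, bracket_nil, mul_one, pow_zero, one_smul, liftIter_succ, ← map_mul,
      pieceEnd]
    simp only [map_add, map_smul, map_one] at this ⊢
    simpa only [map_add, map_smul, map_one] using congrArg (liftIter i) this

theorem bracket_replicate (A : R) (n i : ℕ) (g : Piece) :
    bracket A (List.replicate n (i, g)) = liftIter i (pieceEnd A g ^ n) := by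
  simp [bracket]

theorem bracket_localFiveMove (hA : A ^ 4 = -1) (h5 : (5 : R) = 0) {a b : Word}
    (h : LocalFiveMove a b) : ∃ k : ℕ, bracket A a = A ^ k • bracket A b := by
  cases h with
  | pos i =>
    refine ⟨3, ?_⟩
    rw [bracket_replicate, pieceEnd, skein_pow_five h5 (hook_sq hA), map_smul, map_one, smul_smul,
      show A ^ 3 * A ^ 5 = 1 by linear_combination (A ^ 4 - 1) * hA, one_smul, bracket_nil]
  | neg i =>
    refine ⟨5, ?_⟩
    rw [bracket_replicate, pieceEnd, skein_pow_five h5 (hook_sq hA), map_smul, map_one, smul_smul,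
      show A ^ 5 * (-A ^ 3) ^ 5 = 1 by
        linear_combination (-A ^ 16 + A ^ 12 - A ^ 8 + A ^ 4 - 1) * hA,
      one_smul, bracket_nil]

theorem bracket_inContext {r : Word → Word → Prop}
    (hr : ∀ a b, r a b → ∃ k : ℕ, bracket A a = A ^ k • bracket A b) {w w' : Word}
    (h : InContext r w w') : ∃ k : ℕ, bracket A w = A ^ k • bracket A w' := by
  obtain ⟨u, v, a, b, hab, rfl, rfl⟩ := h
  obtain ⟨k, hk⟩ := hr a b hab
  exact ⟨k, by simp only [bracket_append, hk, mul_smul_comm, smul_mul_assoc]⟩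

/-- Up to powers of `A`, the bracket is invariant under isotopy and `5`-moves. -/
theorem bracket_fiveMoveEquiv (hA : A ^ 4 = -1) (h5 : (5 : R) = 0) {n m : ℕ} {S T : Tangle n m}
    (h : S.FiveMoveEquiv T) : ∃ k : ℕ, bracket A S.1 = A ^ k • bracket A T.1 := by
  induction h with
  | rel S T h =>
    exact h.elim (bracket_inContext fun _ _ => bracket_localIsotopy hA)
      (bracket_inContext fun _ _ => bracket_localFiveMove hA h5)
  | refl S => exact ⟨0, by rw [pow_zero, one_smul]⟩
  | symm S T _ ih =>
    obtain ⟨k, hk⟩ := ih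
    -- Since `A ^ 8 = 1`, the inverse of `A ^ k` is `A ^ (7 * k)`, so natural exponents suffice.
    refine ⟨7 * k, ?_⟩
    have h8 : A ^ 8 = 1 := by linear_combination (A ^ 4 - 1) * hA
    rw [hk, smul_smul, ← pow_add, show 7 * k + k = 8 * k by ring, pow_mul, h8, one_pow, one_smul]
  | trans S T U _ _ ih1 ih2 =>
    obtain ⟨k, hk⟩ := ih1
    obtain ⟨l, hl⟩ := ih2
    exact ⟨k + l, by rw [hk, hl, smul_smul, pow_add]⟩

/-! ### Brackets of 2-tangles as pairs of coefficients -/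

/-- The bracket of `w` is `p [∞] + q [0]`. -/
def HasBracket (A : R) (w : Word) (p q : R) : Prop :=
  bracket A w = p • 1 + q • (cupEnd A * capEnd A)

/-- Stacking `[0]` on `[0]` closes a loop, so there is no `q * q'` term and the ratio `q / p` is
additive. -/
theorem HasBracket.stack (hA : A ^ 4 = -1) {S T : Tangle 2 2} {p q p' q' : R}
    (hS : HasBracket A S.1 p q) (hT : HasBracket A T.1 p' q') :
    HasBracket A (S.stack T).1 (p * p') (p * q' + q * p') := by
  have : (S.stack T).1 = S.1 ++ T.1 := rfl
  rw [HasBracket, this, bracket_append, hS, hT, skein_mul (hook_sq hA)]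

/-- Dually, `[∞]` beside `[∞]` encloses a loop, so the `p * p'` term vanishes and `p / q` is
additive, as for fractions. -/
theorem HasBracket.beside (hA : A ^ 4 = -1) {S T : Tangle 2 2} {p q p' q' : R}
    (hS : HasBracket A S.1 p q) (hT : HasBracket A T.1 p' q') :
    HasBracket A (S.beside T).1 (p * q' + q * p') (q * q') := by
  have : (S.beside T).1 = (1, .cap) :: (S.1 ++ shift 2 T.1 ++ [(1, .cup)]) := rfl
  rw [HasBracket, this, bracket_cons, bracket_append, bracket_append, bracket_shift, hS, hT]
  simp only [bracket_cons, bracket_nil, mul_one, liftIter_succ, liftIter_zero, pieceEnd]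
  have h0 : liftEnd (capEnd A) * liftEnd (cupEnd A) = 0 := by
    rw [← map_mul, cap_mul_cup_self hA, map_zero]
  have h1 : cupEnd A * capEnd A * liftEnd (cupEnd A) = cupEnd A := hook_mul_lift_cup hA
  have h2 : liftEnd (liftEnd (cupEnd A * capEnd A)) * liftEnd (cupEnd A) =
      liftEnd (liftEnd (cupEnd A)) := by
    rw [← map_mul, lift_hook_mul_cup hA]
  have h3 : liftEnd (capEnd A) * liftEnd (liftEnd (cupEnd A)) = 1 := by
    rw [← map_mul, cap_mul_lift_cup hA, map_one]
  have h4 : liftEnd (capEnd A) * (cupEnd A * capEnd A * liftEnd (liftEnd (cupEnd A))) =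
      cupEnd A * capEnd A := by
    rw [mul_assoc (cupEnd A), cap_exchange, ← mul_assoc, lift_cap_mul_cup hA, one_mul]
  simp only [map_add, map_smul, map_one, add_mul, mul_add, smul_mul_assoc, mul_smul_comm, one_mul,
    mul_one, mul_assoc, add_smul]
  simp only [mul_assoc] at h0 h1 h2 h3 h4
  have h5 := lift_cap_mul_cup hA
  simp only [h0, h1, h2, h3, h4, h5, smul_zero, zero_add, smul_add, smul_smul]
  rw [mul_comm q p', mul_comm p q', mul_comm q q']
  abel

theorem HasBracket.coeff_eq (hA : A ^ 4 = -1) {S T : Tangle 2 2} {p q p' q' : R}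
    (hS : HasBracket A S.1 p q) (hT : HasBracket A T.1 p' q') {k : ℕ}
    (h : bracket A S.1 = A ^ k • bracket A T.1) : p = A ^ k * p' ∧ q = A ^ k * q' := by
  rw [hS, hT] at h
  let z : Stream' Bool := Stream'.const false
  have eval : ∀ (p q : R) (f : StateFun R) (x y : Bool),
      (p • (1 : Module.End R (StateFun R)) + q • (cupEnd A * capEnd A)) f
        (Stream'.cons x (Stream'.cons y z)) =
      p * f (Stream'.cons x (Stream'.cons y z)) + q * (pairing A x y *
        (A ^ 3 * f (Stream'.cons false (Stream'.cons true z)) +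
          -A * f (Stream'.cons true (Stream'.cons false z)))) := fun _ _ _ _ _ => rfl
  have hsm : ∀ (f : StateFun R) (s : Stream' Bool),
      (A ^ k • (p' • (1 : Module.End R (StateFun R)) + q' • (cupEnd A * capEnd A))) f s =
      A ^ k * (p' • (1 : Module.End R (StateFun R)) + q' • (cupEnd A * capEnd A)) f s :=
    fun _ _ => rfl
  constructor
  -- The pairing vanishes on equal states, so only the coefficient of `[∞]` is seen.
  · have := congrFun (LinearMap.congr_fun h fun _ => 1) (Stream'.cons false (Stream'.cons false z))
    rw [hsm, eval, eval] at this
    simpa [pairing] using this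
  -- This function vanishes at the chosen state, which removes the coefficient of `[∞]`; the other
  -- one appears with the factor `-A * A ^ 3 = 1`.
  · have := congrFun (LinearMap.congr_fun h fun s => if s.head then 0 else 1)
      (Stream'.cons true (Stream'.cons false z))
    rw [hsm, eval, eval] at this
    simp only [pairing, Stream'.head_cons, if_true, Bool.false_eq_true, if_false] at this
    linear_combination this + (q - A ^ k * q') * hA

end Bracket

/-! ### The twelve brackets and their comparison -/

/-- The ring `𝔽₅[x] / (x ^ 4 + 1) = 𝔽₅[x] / (x ^ 2 - 2) × 𝔽₅[x] / (x ^ 2 + 2)`. -/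
abbrev EighthRootRing :=
  QuadraticAlgebra (ZMod 5) 2 0 × QuadraticAlgebra (ZMod 5) (-2) 0

/-- The class of `x` in `𝔽₅[x] / (x ^ 4 + 1)`. -/
def eighthRoot : EighthRootRing := (⟨0, 1⟩, ⟨0, 1⟩)

theorem eighthRoot_pow_four : eighthRoot ^ 4 = -1 := by decide

/-- The coefficients `(p, q)` of the brackets `p [∞] + q [0]` of the basic tangles. -/
def basicBracket : Fin 12 → EighthRootRing × EighthRootRing :=
  let stack (x y : EighthRootRing × EighthRootRing) : EighthRootRing × EighthRootRing :=
    (x.1 * y.1, x.1 * y.2 + x.2 * y.1)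
  let beside (x y : EighthRootRing × EighthRootRing) : EighthRootRing × EighthRootRing :=
    (x.1 * y.2 + x.2 * y.1, x.2 * y.2)
  let one := (eighthRoot, -eighthRoot ^ 3)
  let negOne := (-eighthRoot ^ 3, eighthRoot)
  ![(1, 0), (0, 1), negOne, one, beside negOne negOne, beside one one,
    stack (stack one one) (beside one one), beside (beside one one) (stack one one),
    beside one (stack one one), beside negOne (stack negOne negOne),
    stack one one, stack negOne negOne]

theorem hasBracket_basic (i : Fin 12) :
    HasBracket eighthRoot (Tangle.basic i).1 (basicBracket i).1 (basicBracket i).2 := by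
  have hA := eighthRoot_pow_four
  have hinf : HasBracket eighthRoot Tangle.infty.1 1 0 := by
    simp [HasBracket, Tangle.infty]
  have hzero : HasBracket eighthRoot Tangle.zero.1 0 1 := by
    simp [HasBracket, Tangle.zero, liftIter_zero, pieceEnd]
  have hone : HasBracket eighthRoot Tangle.one.1 eighthRoot (-eighthRoot ^ 3) := by
    simp [HasBracket, Tangle.one, liftIter_zero, pieceEnd]
  have hneg : HasBracket eighthRoot Tangle.negOne.1 (-eighthRoot ^ 3) eighthRoot := by
    simp [HasBracket, Tangle.negOne, liftIter_zero, pieceEnd]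
  have htwo := hone.beside hA hone
  have hhalf := hone.stack hA hone
  fin_cases i
  · exact hinf
  · exact hzero
  · exact hneg
  · exact hone
  · exact hneg.beside hA hneg
  · exact htwo
  · exact hhalf.stack hA htwo
  · exact htwo.beside hA hhalf
  · exact hone.beside hA hhalf
  · exact hneg.beside hA (hneg.stack hA hneg)
  · exact hhalf
  · exact hneg.stack hA hneg

-- Both factors of the ring are needed. In either one, `A ^ 2 = ±2` is a scalar of `𝔽₅`, so powers
-- of `A` would already identify `(1, 0)` for `[1/0]` with `(2 A ^ 2, 0)` for `[2/5]`. In the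
-- product the only scalar powers of `A` are `±1`.
set_option maxRecDepth 100000 in
theorem basicBracket_distinct : ∀ i j : Fin 12, i ≠ j → ∀ k : Fin 8,
    basicBracket i ≠ (eighthRoot ^ k.1 * (basicBracket j).1,
      eighthRoot ^ k.1 * (basicBracket j).2) := by
  decide

end TangleDiagram

/-- The basic tangles are pairwise inequivalent. -/
theorem Tangle.not_fiveMoveEquiv_basic {i j : Fin 12} (hij : i ≠ j) :
    ¬ (Tangle.basic i).FiveMoveEquiv (Tangle.basic j) := by
  intro h
  have hA := eighthRoot_pow_four
  obtain ⟨k, hk⟩ := bracket_fiveMoveEquiv hA (by decide) h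
  obtain ⟨hp, hq⟩ := (hasBracket_basic i).coeff_eq hA (hasBracket_basic j) hk
  have h8 : eighthRoot ^ k = eighthRoot ^ (k % 8) := by
    conv_lhs => rw [← Nat.div_add_mod k 8, pow_add, pow_mul,
      show eighthRoot ^ 8 = 1 by decide, one_pow, one_mul]
  refine basicBracket_distinct i j hij ⟨k % 8, Nat.mod_lt _ (by norm_num)⟩ ?_
  rw [h8] at hp hq
  exact Prod.ext hp hq

/-! ### Equivalence of words: compatibility with composition, side-by-side diagrams -/

namespace TangleDiagram

theorem InContext.append {r : Word → Word → Prop} {w w' : Word}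
    (h : InContext r w w') (u v : Word) : InContext r (u ++ w ++ v) (u ++ w' ++ v) := by
  obtain ⟨x, y, a, b, hab, rfl, rfl⟩ := h
  exact ⟨u ++ x, y ++ v, a, b, hab, by simp, by simp⟩

theorem shift_append (k : ℕ) (u v : Word) :
    shift k (u ++ v) = shift k u ++ shift k v :=
  List.map_append

theorem shift_shift (k l : ℕ) (u : Word) :
    shift k (shift l u) = shift (k + l) u := by
  simp [shift, Nat.add_assoc]

theorem InContext.shift {r : Word → Word → Prop} {k : ℕ}
    (hr : ∀ a b, r a b → r (TangleDiagram.shift k a) (TangleDiagram.shift k b)) {w w' : Word}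
    (h : InContext r w w') :
    InContext r (TangleDiagram.shift k w) (TangleDiagram.shift k w') := by
  obtain ⟨x, y, a, b, hab, rfl, rfl⟩ := h
  exact ⟨TangleDiagram.shift k x, TangleDiagram.shift k y, _, _, hr a b hab,
    by simp only [shift_append], by simp only [shift_append]⟩

theorem LocalIsotopy.shift {a b : Word} (k : ℕ) (h : LocalIsotopy a b) :
    LocalIsotopy (TangleDiagram.shift k a) (TangleDiagram.shift k b) := by
  cases h with
  | exchange i j g h =>
    have := LocalIsotopy.exchange (k + i) j g h
    simpa only [TangleDiagram.shift, List.map_cons, List.map_nil, Nat.add_assoc] using this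
  | zigzag_right i => exact .zigzag_right (k + i)
  | zigzag_left i => exact .zigzag_left (k + i)
  | slide_cap_pos i => exact .slide_cap_pos (k + i)
  | slide_cap_neg i => exact .slide_cap_neg (k + i)
  | slide_cup_pos i => exact .slide_cup_pos (k + i)
  | slide_cup_neg i => exact .slide_cup_neg (k + i)
  | r1_cap_pos i => exact .r1_cap_pos (k + i)
  | r1_cap_neg i => exact .r1_cap_neg (k + i)
  | r1_cup_pos i => exact .r1_cup_pos (k + i)
  | r1_cup_neg i => exact .r1_cup_neg (k + i)
  | r2_pos_neg i => exact .r2_pos_neg (k + i)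
  | r2_neg_pos i => exact .r2_neg_pos (k + i)
  | r3 i => exact .r3 (k + i)

theorem LocalFiveMove.shift {a b : Word} (k : ℕ) (h : LocalFiveMove a b) :
    LocalFiveMove (TangleDiagram.shift k a) (TangleDiagram.shift k b) := by
  cases h with
  | pos i => exact .pos (k + i)
  | neg i => exact .neg (k + i)

/-- `5`-move equivalence of words, as diagrams of tangles with `n` upper and `m` lower ends. -/
def WordEquiv (n m : ℕ) (a b : Word) : Prop :=
  ∃ (ha : Typed a n m) (hb : Typed b n m),
    Tangle.FiveMoveEquiv (⟨a, ha⟩ : Tangle n m) (⟨b, hb⟩ : Tangle n m)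

namespace WordEquiv

variable {n m p q : ℕ} {a b c u v : Word}

theorem refl (h : Typed a n m) : WordEquiv n m a a := ⟨h, h, .refl _⟩

theorem symm (h : WordEquiv n m a b) : WordEquiv n m b a := by
  obtain ⟨ha, hb, h⟩ := h
  exact ⟨hb, ha, .symm _ _ h⟩

theorem trans (h : WordEquiv n m a b) (h' : WordEquiv n m b c) : WordEquiv n m a c := by
  obtain ⟨ha, hb, h⟩ := h
  obtain ⟨_, hc, h'⟩ := h'
  exact ⟨ha, hc, .trans _ _ _ h h'⟩

theorem of_local (h : LocalIsotopy a b) (ha : Typed a n m) (hb : Typed b n m) :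
    WordEquiv n m a b :=
  ⟨ha, hb, .rel _ _ (.inl ⟨[], [], a, b, h, by simp, by simp⟩)⟩

theorem of_five (h : LocalFiveMove a b) (ha : Typed a n m) (hb : Typed b n m) :
    WordEquiv n m a b :=
  ⟨ha, hb, .rel _ _ (.inr ⟨[], [], a, b, h, by simp, by simp⟩)⟩

/-- A map of words that respects types and moves respects equivalence. -/
theorem map (F : Word → Word) (hF : ∀ w, Typed w p q → Typed (F w) n m)
    (hI : ∀ w w', InContext LocalIsotopy w w' → InContext LocalIsotopy (F w) (F w'))
    (h5 : ∀ w w', InContext LocalFiveMove w w' → InContext LocalFiveMove (F w) (F w'))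
    (h : WordEquiv p q a b) : WordEquiv n m (F a) (F b) := by
  obtain ⟨ha, hb, h⟩ := h
  refine ⟨hF a ha, hF b hb, ?_⟩
  have key : ∀ S T : Tangle p q, S.FiveMoveEquiv T →
      Tangle.FiveMoveEquiv (⟨F S.1, hF _ S.2⟩ : Tangle n m) ⟨F T.1, hF _ T.2⟩ := by
    intro S T h
    induction h with
    | rel S T h => exact .rel _ _ (h.imp (hI _ _) (h5 _ _))
    | refl S => exact .refl _
    | symm S T _ ih => exact .symm _ _ ih
    | trans S T U _ _ ih ih' => exact .trans _ _ _ ih ih'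
  exact key _ _ h

theorem append (h : WordEquiv p q a b) (hu : Typed u n p) (hv : Typed v q m) :
    WordEquiv n m (u ++ a ++ v) (u ++ b ++ v) :=
  map (fun w => u ++ w ++ v) (fun _ hw => (hu.append hw).append hv)
    (fun _ _ h => h.append u v) (fun _ _ h => h.append u v) h

theorem append_left (h : WordEquiv p m a b) (hu : Typed u n p) :
    WordEquiv n m (u ++ a) (u ++ b) := by
  simpa using h.append hu (v := []) rfl

theorem append_right (h : WordEquiv n q a b) (hv : Typed v q m) :
    WordEquiv n m (a ++ v) (b ++ v) := by
  simpa using h.append (u := []) rfl hv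

theorem add_right (h : WordEquiv n m a b) (k : ℕ) : WordEquiv (n + k) (m + k) a b :=
  map id (fun _ hw => hw.add_right k) (fun _ _ h => h) (fun _ _ h => h) h

theorem shift (h : WordEquiv n m a b) (k : ℕ) :
    WordEquiv (k + n) (k + m) (TangleDiagram.shift k a) (TangleDiagram.shift k b) :=
  map (TangleDiagram.shift k) (fun _ hw => hw.shift k)
    (fun _ _ h => h.shift fun _ _ => .shift k) (fun _ _ h => h.shift fun _ _ => .shift k) h

/-- A slice changes heights with a diagram to its right. -/
theorem exchange_slice {i : ℕ} {g : Piece} (hi : i + g.dom ≤ n) (hv : Typed v p q) :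
    WordEquiv (n + p) (n - g.dom + g.cod + q)
      ((i, g) :: TangleDiagram.shift (n - g.dom + g.cod) v)
      (TangleDiagram.shift n v ++ [(i, g)]) := by
  have hg : Typed [(i, g)] n (n - g.dom + g.cod) := ⟨hi, rfl⟩
  induction v generalizing p with
  | nil =>
    obtain rfl : p = q := hv
    exact refl (hg.add_right p)
  | cons s v ih =>
    obtain ⟨j, h⟩ := s
    obtain ⟨hj, hv⟩ := hv
    have h1 : WordEquiv (n + p) (n - g.dom + g.cod + (p - h.dom + h.cod))
        [(i, g), (n - g.dom + g.cod + j, h)] [(n + j, h), (i, g)] := by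
      refine of_local ?_ ?_ ?_
      -- The gap between the pieces consists of the `n - g.dom - i` strands to the right of `g` and
      -- the `j` strands to the left of `h`.
      · have := LocalIsotopy.exchange i (n - g.dom - i + j) g h
        rwa [show i + g.cod + (n - g.dom - i + j) = n - g.dom + g.cod + j by omega,
          show i + g.dom + (n - g.dom - i + j) = n + j by omega] at this
      · refine ⟨by omega, ⟨by omega, ?_⟩⟩
        simp only [Typed]; omega
      · refine ⟨by omega, ⟨by omega, ?_⟩⟩
        simp only [Typed]; omega
    have h2 := h1.append_right (hv.shift (n - g.dom + g.cod))
    have h3 := (ih hv).append_left (u := [(n + j, h)]) (n := n + p)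
      ⟨by omega, by simp only [Typed]; omega⟩
    exact h2.trans h3

/-- Diagrams that lie side by side change their heights. -/
theorem exchange (hu : Typed u n m) (hv : Typed v p q) :
    WordEquiv (n + p) (m + q) (u ++ TangleDiagram.shift m v) (TangleDiagram.shift n v ++ u) := by
  induction u generalizing n with
  | nil =>
    obtain rfl : n = m := hu
    have := refl (hv.shift n)
    simpa using this
  | cons s u ih =>
    obtain ⟨i, g⟩ := s
    obtain ⟨hi, hu⟩ := hu
    have h1 := (ih hu).append_left (u := [(i, g)]) (n := n + p)
      ⟨by omega, by simp only [Typed]; omega⟩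
    have h2 := (exchange_slice hi hv).append_right (hu.add_right q)
    simpa using h1.trans h2

end WordEquiv

/-- The crossings. -/
def crossing : Bool → Piece
  | true => .pos
  | false => .neg

theorem dom_crossing (s : Bool) : (crossing s).dom = 2 := by cases s <;> rfl

theorem cod_crossing (s : Bool) : (crossing s).cod = 2 := by cases s <;> rfl

theorem localIsotopy_slide_cap (s : Bool) (i : ℕ) :
    LocalIsotopy [(i, .cap), (i + 1, crossing s)] [(i + 1, .cap), (i, crossing !s)] := by
  cases s
  · exact .slide_cap_neg i
  · exact .slide_cap_pos i

theorem localIsotopy_slide_cup (s : Bool) (i : ℕ) :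
    LocalIsotopy [(i + 1, crossing s), (i, .cup)] [(i, crossing !s), (i + 1, .cup)] := by
  cases s
  · exact .slide_cup_neg i
  · exact .slide_cup_pos i

theorem localIsotopy_r1_cap (s : Bool) (i : ℕ) :
    LocalIsotopy [(i, .cap), (i, crossing s)] [(i, .cap)] := by
  cases s
  · exact .r1_cap_neg i
  · exact .r1_cap_pos i

theorem localIsotopy_r1_cup (s : Bool) (i : ℕ) :
    LocalIsotopy [(i, crossing s), (i, .cup)] [(i, .cup)] := by
  cases s
  · exact .r1_cup_neg i
  · exact .r1_cup_pos i

theorem localIsotopy_r2 (s : Bool) (i : ℕ) :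
    LocalIsotopy [(i, crossing s), (i, crossing !s)] [] := by
  cases s
  · exact .r2_neg_pos i
  · exact .r2_pos_neg i

theorem localFiveMove_crossing (s : Bool) (i : ℕ) :
    LocalFiveMove [] (List.replicate 5 (i, crossing s)) := by
  cases s
  · exact .neg i
  · exact .pos i

end TangleDiagram

/-! ### Algebra of twist pairs and the orbit of twelve points -/

/-- Permutations `a` and `b` of order five, with inverses `a'` and `b'`, such that `a'` and `b`
satisfy the braid relation. -/
structure BraidPair {X : Type*} (a a' b b' : X → X) : Prop where
  fst_inv : ∀ x, a (a' x) = x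
  inv_fst : ∀ x, a' (a x) = x
  snd_inv : ∀ x, b (b' x) = x
  inv_snd : ∀ x, b' (b x) = x
  fst_pow : ∀ x, a (a (a (a (a x)))) = x
  snd_pow : ∀ x, b (b (b (b (b x)))) = x
  braid : ∀ x, b (a' (b x)) = a' (b (a' x))

/-- Transfers the relations from tangles with a bent end, where they are braid moves, to 2-tangles.
-/
theorem BraidPair.of_injective {X Y : Type*} {a a' b b' : X → X} {c c' d d' : Y → Y}
    (h : BraidPair c c' d d') {f : X → Y} (hf : Function.Injective f)
    (ha : ∀ x, f (a x) = c (f x)) (ha' : ∀ x, f (a' x) = c' (f x))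
    (hb : ∀ x, f (b x) = d (f x)) (hb' : ∀ x, f (b' x) = d' (f x)) : BraidPair a a' b b' where
  fst_inv x := hf (by rw [ha, ha', h.fst_inv])
  inv_fst x := hf (by rw [ha', ha, h.inv_fst])
  snd_inv x := hf (by rw [hb, hb', h.snd_inv])
  inv_snd x := hf (by rw [hb', hb, h.inv_snd])
  fst_pow x := hf (by simp only [ha, h.fst_pow])
  snd_pow x := hf (by simp only [hb, h.snd_pow])
  braid x := hf (by simp only [ha', hb, h.braid])

/-- Permutations `a` and `b` that act like adding `1` to a fraction and to its reciprocal, with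
`z` and `w` in the place of the fractions `0` and `1 / 0`, modulo five. -/
structure TwistPair {X : Type*} (a a' b b' : X → X) (z w : X) : Prop
    extends BraidPair a a' b b' where
  fst_infty : a w = w
  snd_zero : b z = z
  one_eq : b w = a z
  negOne_eq : b' w = a' z

/-- The orbit of `w` under a twist pair, in the order of `Tangle.basic`. -/
def twistOrbit {X : Type*} (a a' b b' : X → X) (z w : X) : Fin 12 → X :=
  ![w, z, a' z, a z, a' (a' z), a (a z), b (b (a (a z))), a (a (b (b w))), a (b (b w)),
    a' (b' (b' w)), b (b w), b' (b' w)]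

/-- The action of the first permutation of a twist pair on the orbit. -/
def twistFst : Fin 12 → Fin 12 := ![0, 3, 1, 5, 2, 4, 6, 9, 7, 11, 8, 10]

/-- The action of the second permutation of a twist pair on the orbit. -/
def twistSnd : Fin 12 → Fin 12 := ![3, 1, 0, 10, 5, 8, 9, 7, 6, 4, 11, 2]

namespace TwistPair

variable {X : Type*} {a a' b b' l l' t t' : X → X} {z w : X}

theorem inv_fst_eq (h : TwistPair a a' b b' z w) (x : X) : a' x = a (a (a (a x))) := by
  rw [← h.fst_pow (a' x), h.fst_inv]

theorem inv_snd_eq (h : TwistPair a a' b b' z w) (x : X) : b' x = b (b (b (b x))) := by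
  rw [← h.snd_pow (b' x), h.snd_inv]

theorem braid_inv (h : TwistPair a a' b b' z w) (x : X) : b' (a (b' x)) = a (b' (a x)) := by
  have := h.braid (b' (a (b' x)))
  rw [h.snd_inv, h.inv_fst, h.snd_inv] at this
  conv_rhs => rw [this, h.fst_inv, h.inv_snd, h.fst_inv]

theorem snd_conj_fst (h : TwistPair a a' b b' z w) (x : X) : b (a (b' x)) = a (b' (a' x)) := by
  rw [← h.snd_inv (a (b' (a' x))), h.braid_inv, h.fst_inv]

theorem fst_inv_conj_snd (h : TwistPair a a' b b' z w) (x : X) :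
    a' (b (a x)) = b' (a' (b x)) := by
  rw [← h.inv_snd (a' (b (a x))), h.braid, h.inv_fst]

/-- In fractions, `-1/2 + 1 = 1/2`; the braid relation alone carries this, without order five. -/
theorem fst_negHalf (h : TwistPair a a' b b' z w) : a (b' (b' w)) = b (b w) := by
  rw [h.negOne_eq, ← h.snd_conj_fst, show b' z = z by conv_lhs => rw [← h.snd_zero, h.inv_snd],
    ← h.one_eq]

theorem snd_negTwo (h : TwistPair a a' b b' z w) : b (a' (a' z)) = a (a z) := by
  have := h.braid (b' (b' w))
  rw [h.snd_inv] at this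
  grind [TwistPair, BraidPair]

/-- The fractions are `2/3` and `3/2`, which agree only modulo five and up to sign: `(2, 3) = -(3,
2)`. -/
theorem snd_two (h : TwistPair a a' b b' z w) : b (a (a z)) = a (b (b w)) := by
  have := h.fst_inv_conj_snd (a z)
  have := h.fst_negHalf
  have := h.inv_snd_eq
  grind [TwistPair, BraidPair]

theorem inv_snd_negTwo (h : TwistPair a a' b b' z w) : b' (a' (a' z)) = a' (b' (b' w)) := by
  have := h.snd_conj_fst (a' z)
  have := h.fst_negHalf
  have := h.inv_snd_eq
  grind [TwistPair, BraidPair]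

theorem snd_twoFifths (h : TwistPair a a' b b' z w) :
    b (b (b (a (a z)))) = a' (b' (b' w)) := by
  rw [← h.inv_snd_negTwo, h.inv_snd_eq, h.snd_negTwo]

/-- Modulo five, `2/5` is `2/0`, a second fixed point of adding `1` besides `1/0`. -/
theorem fst_twoFifths (h : TwistPair a a' b b' z w) :
    a (b (b (a (a z)))) = b (b (a (a z))) := by
  have h1 := h.braid_inv (a' (b' (b' w)))
  rw [h.fst_inv, ← h.snd_twoFifths, h.inv_snd] at h1
  have h2 := h.snd_two
  have h3 : b' (b' (b' w)) = b (b w) := by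
    conv_lhs => rw [← h.snd_pow w, h.inv_snd, h.inv_snd, h.inv_snd]
  grind [TwistPair, BraidPair]

theorem snd_fiveHalves (h : TwistPair a a' b b' z w) :
    b (a (a (b (b w)))) = a (a (b (b w))) := by
  have h1 := h.snd_conj_fst (b (b (a (a z))))
  have h2 := h.snd_two
  have h3 := h.fst_twoFifths
  grind [TwistPair, BraidPair]

/-- The table has two fixed points, `1/0` and `2/5`, and two cycles of length five: the fractions of
denominator `±1` and those of denominator `±2` modulo five. -/
theorem fst_orbit (h : TwistPair a a' b b' z w) (i : Fin 12) :
    a (twistOrbit a a' b b' z w i) = twistOrbit a a' b b' z w (twistFst i) := by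
  have h1 := h.inv_fst_eq
  have h2 := h.fst_negHalf
  fin_cases i
  · exact h.fst_infty
  · rfl
  · exact h.fst_inv _
  · rfl
  · exact h.fst_inv _
  · change a (a (a z)) = a' (a' z)
    grind [TwistPair, BraidPair]
  · exact h.fst_twoFifths
  · change a (a (a (b (b w)))) = a' (b' (b' w))
    grind [TwistPair, BraidPair]
  · rfl
  · exact h.fst_inv _
  · rfl
  · exact h2

theorem snd_orbit (h : TwistPair a a' b b' z w) (i : Fin 12) :
    b (twistOrbit a a' b b' z w i) = twistOrbit a a' b b' z w (twistSnd i) := by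
  fin_cases i
  · exact h.one_eq
  · exact h.snd_zero
  · change b (a' z) = w
    rw [← h.negOne_eq, h.snd_inv]
  · change b (a z) = b (b w)
    rw [h.one_eq]
  · exact h.snd_negTwo
  · exact h.snd_two
  · exact h.snd_twoFifths
  · exact h.snd_fiveHalves
  · change b (a (b (b w))) = b (b (a (a z)))
    rw [h.snd_two]
  · change b (a' (b' (b' w))) = a' (a' z)
    rw [← h.inv_snd_negTwo, h.snd_inv]
  · change b (b (b w)) = b' (b' w)
    have := h.inv_snd_eq
    grind [TwistPair, BraidPair]
  · change b (b' (b' w)) = a' z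
    rw [h.snd_inv, h.negOne_eq]

/-- The orbit does not change if the first permutation is replaced by one that commutes with it. -/
theorem orbit_eq_of_fst_comm (h : TwistPair a a' b b' z w) (h' : TwistPair l l' b b' z w)
    (hal : ∀ x, a (l x) = l (a x)) : twistOrbit l l' b b' z w = twistOrbit a a' b b' z w := by
  -- Both `l z` and `a z` equal `b w`, so commutation gives `l (l z) = l (a z) = a (l z) = a (a z)`.
  -- The relations of the two twist pairs then carry this agreement to the rest of the orbit.
  have h2 : l (l z) = a (a z) := by
    have := h.one_eq
    have := h'.one_eq
    grind
  have h8 : l (b (b w)) = a (b (b w)) := by rw [← h.snd_two, ← h'.snd_two, h2]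
  have h9 : l' (b' (b' w)) = a' (b' (b' w)) := by
    rw [← h.snd_twoFifths, ← h'.snd_twoFifths, h2]
  have h4 : l' (l' z) = a' (a' z) := by
    rw [← h.snd_inv (a' (a' z)), ← h.snd_inv (l' (l' z)), h.inv_snd_negTwo, h'.inv_snd_negTwo, h9]
  have h7 : l (l (b (b w))) = a (a (b (b w))) := by rw [h8, ← hal, h8]
  have h3 : l z = a z := by rw [← h.one_eq, ← h'.one_eq]
  have h5 : l' z = a' z := by rw [← h.negOne_eq, ← h'.negOne_eq]
  rw [twistOrbit, twistOrbit, h4, h2, h7, h8, h9, h3, h5]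

/-- The orbit does not change if the second permutation is replaced by one that commutes with
it. -/
theorem orbit_eq_of_snd_comm (h : TwistPair a a' b b' z w) (h' : TwistPair a a' t t' z w)
    (hbt : ∀ x, b (t x) = t (b x)) : twistOrbit a a' t t' z w = twistOrbit a a' b b' z w := by
  have h10 : t (t w) = b (b w) := by
    have := h.one_eq
    have := h'.one_eq
    grind
  have h11 : t' (t' w) = b' (b' w) := by
    -- Both sides are compared after applying the injective map `a`, which turns `-1/2` into `1/2`.
    rw [← h.inv_fst (t' _), ← h.inv_fst (b' (b' w)), h.fst_negHalf, h'.fst_negHalf, h10]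
  have h5 : t (a (a z)) = b (a (a z)) := by rw [h.snd_two, h'.snd_two, h10]
  have h6 : t (t (a (a z))) = b (b (a (a z))) := by rw [h5, ← hbt, h5]
  simp only [twistOrbit, h6, h10, h11]

theorem fst_mem_range (h : TwistPair a a' b b' z w) {x : X}
    (hx : x ∈ Set.range (twistOrbit a a' b b' z w)) :
    a x ∈ Set.range (twistOrbit a a' b b' z w) ∧ a' x ∈ Set.range (twistOrbit a a' b b' z w) := by
  have key : ∀ y ∈ Set.range (twistOrbit a a' b b' z w),
      a y ∈ Set.range (twistOrbit a a' b b' z w) := by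
    rintro _ ⟨i, rfl⟩
    exact ⟨_, (h.fst_orbit i).symm⟩
  refine ⟨key x hx, ?_⟩
  rw [h.inv_fst_eq]
  exact key _ (key _ (key _ (key _ hx)))

theorem snd_mem_range (h : TwistPair a a' b b' z w) {x : X}
    (hx : x ∈ Set.range (twistOrbit a a' b b' z w)) :
    b x ∈ Set.range (twistOrbit a a' b b' z w) ∧ b' x ∈ Set.range (twistOrbit a a' b b' z w) := by
  have key : ∀ y ∈ Set.range (twistOrbit a a' b b' z w),
      b y ∈ Set.range (twistOrbit a a' b b' z w) := by
    rintro _ ⟨i, rfl⟩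
    exact ⟨_, (h.snd_orbit i).symm⟩
  refine ⟨key x hx, ?_⟩
  rw [h.inv_snd_eq]
  exact key _ (key _ (key _ (key _ hx)))

end TwistPair

/-! ### Bending an end and sliding crossings around it -/

namespace TangleDiagram

theorem shift_nil (k : ℕ) : shift k [] = [] := rfl

theorem shift_cons (k i : ℕ) (g : Piece) (w : Word) :
    shift k ((i, g) :: w) = (k + i, g) :: shift k w := rfl

theorem shift_zero (w : Word) : shift 0 w = w := by simp [shift]

namespace WordEquiv

variable {t : Word}

theorem cap_cup_cancel_right (ht : Typed t 2 2) :
    WordEquiv 2 2 ((1, .cap) :: (t ++ [(2, .cup)])) t := by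
  have h1 := (exchange ht (v := [(0, .cup)]) (p := 2) (q := 0)
    (by simp [Typed, Piece.dom, Piece.cod])).append_left (u := [(1, .cap)]) (n := 2)
    (by simp [Typed, Piece.dom, Piece.cod])
  have h2 := (of_local (n := 2) (m := 2) (.zigzag_right 1)
    (by simp [Typed, Piece.dom, Piece.cod]) rfl).append_right ht
  exact h1.trans h2

theorem cap_cup_cancel_left (ht : Typed t 2 2) :
    WordEquiv 2 2 ((1, .cap) :: (TangleDiagram.shift 2 t ++ [(0, .cup)])) t := by
  have h1 := (exchange (u := [(0, .cup)]) (n := 2) (m := 0) (by simp [Typed, Piece.dom, Piece.cod])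
    ht).symm.append_left (u := [(1, .cap)]) (n := 2) (by simp [Typed, Piece.dom, Piece.cod])
  have h2 := (of_local (n := 2) (m := 2) (.zigzag_left 0)
    (by simp [Typed, Piece.dom, Piece.cod]) rfl).append_right ht
  rw [shift_zero] at h1
  exact h1.trans h2

theorem cup_cap_cancel_right (ht : Typed t 2 2) :
    WordEquiv 2 2 ((2, .cap) :: (t ++ [(1, .cup)])) t := by
  have h1 := (exchange ht (v := [(0, .cap)]) (p := 0) (q := 2)
    (by simp [Typed, Piece.dom, Piece.cod])).symm.append_right (v := [(1, .cup)]) (m := 2)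
    (by simp [Typed, Piece.dom, Piece.cod])
  have h2 := (of_local (n := 2) (m := 2) (.zigzag_left 1)
    (by simp [Typed, Piece.dom, Piece.cod]) rfl).append_left ht
  simpa [TangleDiagram.shift] using h1.trans (by simpa [TangleDiagram.shift] using h2)

end WordEquiv

end TangleDiagram

namespace Tangle

/-- A tangle with one crossing. -/
def single (s : Bool) : Tangle 2 2 :=
  ⟨[(0, crossing s)], by cases s <;> simp [Typed, crossing, Piece.dom, Piece.cod]⟩

theorem typed_crossing (s : Bool) {i k : ℕ} (h : i + 2 ≤ k) : Typed [(i, crossing s)] k k := by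
  refine ⟨by rw [dom_crossing]; exact h, ?_⟩
  simp only [Typed, dom_crossing, cod_crossing]
  omega

/-- The added crossing slides around the minimum that joins it to `T`, which reverses its sign; the
minimum then cancels against the maximum made by bending. What remains is a braid generator below
`T`. -/
theorem bend_beside (T : Tangle 2 2) (s : Bool) :
    WordEquiv 1 3 ((1, .cap) :: (T.beside (single s)).1)
      ((1, .cap) :: T.1 ++ [(1, crossing !s)]) := by
  have hc : Typed [(1, .cap)] 1 3 := by simp [Typed, Piece.dom, Piece.cod]
  have hc' : Typed [(1, .cap)] 3 5 := by simp [Typed, Piece.dom, Piece.cod]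
  have hu : Typed ((1, .cap) :: T.1 ++ [(1, crossing !s)]) 1 3 :=
    (hc.append (T.2.add_right 1)).append (typed_crossing _ (by norm_num))
  have h1 := (WordEquiv.of_local (n := 5) (m := 3) (localIsotopy_slide_cup s 1)
      ((typed_crossing s (by norm_num)).append (v := [(1, .cup)])
        (by simp [Typed, Piece.dom, Piece.cod]))
      ((typed_crossing (!s) (by norm_num)).append (v := [(2, .cup)])
        (by simp [Typed, Piece.dom, Piece.cod]))).append_left
    ((hc.append hc').append (T.2.add_right 3))
  have h2 := (WordEquiv.exchange hu (v := [(0, .cap)]) (p := 0) (q := 2)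
    (by simp [Typed, Piece.dom, Piece.cod])).symm.append_right (v := [(2, .cup)]) (m := 3)
    (by simp [Typed, Piece.dom, Piece.cod])
  have h3 := (WordEquiv.of_local (n := 3) (m := 3) (.zigzag_left 2)
    (by simp [Typed, Piece.dom, Piece.cod]) rfl).append_left hu
  have e1 : (1, .cap) :: (T.beside (single s)).1 =
      [(1, .cap)] ++ [(1, .cap)] ++ T.1 ++ [(1 + 1, crossing s), (1, .cup)] := by
    simp [beside, single, shift]
  rw [e1]
  refine h1.trans ?_
  simp only [shift, List.map_cons, List.map_nil, List.append_assoc, List.cons_append,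
    List.nil_append, List.append_nil] at h2 h3 ⊢
  exact h2.trans h3

/-- As on the right, except that the crossing, drawn above `T`, is first lowered past it. -/
theorem bend_left_beside (T : Tangle 2 2) (s : Bool) :
    WordEquiv 1 3 ((0, .cap) :: shift 1 ((single s).beside T).1)
      ((0, .cap) :: shift 1 T.1 ++ [(0, crossing !s)]) := by
  have hc : Typed [(0, .cap)] 1 3 := by simp [Typed, Piece.dom, Piece.cod]
  have hc' : Typed [(2, .cap)] 3 5 := by simp [Typed, Piece.dom, Piece.cod]
  have hu : Typed ((0, .cap) :: shift 1 T.1 ++ [(0, crossing !s)]) 1 3 :=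
    (hc.append (T.2.shift 1)).append (typed_crossing _ (by norm_num))
  have h0 := ((WordEquiv.exchange (single s).2 T.2).shift 1).append (hc.append hc')
    (v := [(2, .cup)]) (m := 3) (by simp [Typed, Piece.dom, Piece.cod])
  have h1 := (WordEquiv.of_local (n := 5) (m := 3) (localIsotopy_slide_cup (!s) 1)
      ((typed_crossing (!s) (by norm_num)).append (v := [(1, .cup)])
        (by simp [Typed, Piece.dom, Piece.cod]))
      ((typed_crossing (!!s) (by norm_num)).append (v := [(2, .cup)])
        (by simp [Typed, Piece.dom, Piece.cod]))).symm.append_left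
    ((hc.append hc').append (T.2.shift 3))
  have h2 := (WordEquiv.exchange (u := [(0, .cap)]) (n := 0) (m := 2)
    (by simp [Typed, Piece.dom, Piece.cod]) hu).append_right (v := [(1, .cup)]) (m := 3)
    (by simp [Typed, Piece.dom, Piece.cod])
  have h3 := (WordEquiv.of_local (n := 3) (m := 3) (.zigzag_right 0)
    (by simp [Typed, Piece.dom, Piece.cod]) rfl).append_left hu
  simp only [single, beside, Bool.not_not, shift_cons, shift_nil, shift_append, shift_shift,
    List.append_assoc, List.cons_append, List.nil_append, List.append_nil, zero_add,
    add_zero, Nat.reduceAdd] at h0 h1 h2 h3 ⊢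
  exact h0.trans (h1.trans (h2.trans h3))

theorem beside_bend (T : Tangle 2 2) (s : Bool) :
    WordEquiv 3 1 ((T.beside (single s)).1 ++ [(1, .cup)])
      ((1, crossing !s) :: T.1 ++ [(1, .cup)]) := by
  have hc : Typed [(1, .cap)] 3 5 := by simp [Typed, Piece.dom, Piece.cod]
  have hd : Typed [(1, .cup), (1, .cup)] 5 1 := by simp [Typed, Piece.dom, Piece.cod]
  have hu : Typed ((1, crossing !s) :: T.1 ++ [(1, .cup)]) 3 1 :=
    (((typed_crossing (!s) (by norm_num)).append (T.2.add_right 1)).append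
      (by simp [Typed, Piece.dom, Piece.cod]))
  have h0 := ((WordEquiv.exchange T.2 (single s).2).add_right 1).append hc hd
  have h1 := (WordEquiv.of_local (n := 3) (m := 5) (localIsotopy_slide_cap s 1)
      (hc.append (typed_crossing s (by norm_num)))
      ((show Typed [(2, .cap)] 3 5 by simp [Typed, Piece.dom, Piece.cod]).append
        (typed_crossing (!s) (by norm_num)))).append_right ((T.2.add_right 3).append hd)
  have h2 := (WordEquiv.exchange hu (v := [(0, .cup)]) (p := 2) (q := 0)
    (by simp [Typed, Piece.dom, Piece.cod])).append_left (u := [(2, .cap)]) (n := 3)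
    (by simp [Typed, Piece.dom, Piece.cod])
  have h3 := (WordEquiv.of_local (n := 3) (m := 3) (.zigzag_right 2)
    (by simp [Typed, Piece.dom, Piece.cod]) rfl).append_right hu
  simp only [single, beside, shift_cons, shift_nil, List.append_assoc, List.cons_append,
    List.nil_append, add_zero, Nat.reduceAdd] at h0 h1 h2 h3 ⊢
  exact h0.trans (h1.trans (h2.trans h3))

/-- Only changes of height are needed. It makes left and right additions commute, and splits `[5/2]`
into single additions. -/
theorem beside_assoc (S T U : Tangle 2 2) :
    WordEquiv 2 2 ((S.beside T).beside U).1 (S.beside (T.beside U)).1 := by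
  have hc : Typed [(1, .cap)] 2 4 := by simp [Typed, Piece.dom, Piece.cod]
  have hc' : Typed [(1, .cap)] 4 6 := by simp [Typed, Piece.dom, Piece.cod]
  have hd : Typed [(1, .cup)] 4 2 := by simp [Typed, Piece.dom, Piece.cod]
  have hS : Typed S.1 6 6 := S.2.add_right 4
  have hT : Typed (shift 2 T.1) 6 6 := (T.2.shift 2).add_right 2
  have hU : Typed (shift 4 U.1) 6 6 := U.2.shift 4
  have h0 := (WordEquiv.exchange hd U.2).append (((hc.append hc').append hS).append hT) hd
  have h1 := (WordEquiv.of_local (n := 6) (m := 2) (.exchange 1 0 .cup .cup)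
    (by simp [Typed, Piece.dom, Piece.cod])
    (by simp [Typed, Piece.dom, Piece.cod])).append_left
      ((((hc.append hc').append hS).append hT).append hU)
  have hd' : Typed [(3, .cup), (1, .cup)] 6 2 := by simp [Typed, Piece.dom, Piece.cod]
  have h2 := (WordEquiv.of_local (n := 2) (m := 6) (.exchange 1 0 .cap .cap)
    (by simp [Typed, Piece.dom, Piece.cod])
    (by simp [Typed, Piece.dom, Piece.cod])).symm.append_right
      (((hS.append hT).append hU).append hd')
  have h3 := (WordEquiv.exchange S.2 hc).symm.append hc ((hT.append hU).append hd')
  simp only [beside, shift_cons, shift_nil, shift_append, shift_shift, List.append_assoc,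
    List.cons_append, List.nil_append, add_zero, Nat.reduceAdd, Piece.dom, Piece.cod]
    at h0 h1 h2 h3 ⊢
  exact h0.trans (h1.trans (h2.trans h3))

end Tangle

/-! ### Equivalence classes and the operations of adding a crossing -/

/-- Tangles up to `5`-move equivalence. -/
def TangleClass (n m : ℕ) : Type :=
  Quotient (⟨Tangle.FiveMoveEquiv, Relation.EqvGen.is_equivalence _⟩ : Setoid (Tangle n m))

namespace TangleClass

variable {n m k l : ℕ}

/-- The class of a tangle. -/
def mk (T : Tangle n m) : TangleClass n m := Quotient.mk _ T

theorem mk_eq_iff {S T : Tangle n m} : mk S = mk T ↔ WordEquiv n m S.1 T.1 := by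
  refine Quotient.eq.trans ⟨fun h => ⟨S.2, T.2, h⟩, fun ⟨_, _, h⟩ => h⟩

theorem ind {P : TangleClass n m → Prop} (h : ∀ T, P (mk T)) (x : TangleClass n m) : P x :=
  Quotient.ind h x

/-- The map on classes that is induced by a map of tangles. -/
def map (F : Tangle n m → Tangle k l)
    (hF : ∀ S T, WordEquiv n m S.1 T.1 → WordEquiv k l (F S).1 (F T).1) :
    TangleClass n m → TangleClass k l :=
  Quotient.lift (fun T => mk (F T)) fun S T h => mk_eq_iff.2 (hF S T ⟨S.2, T.2, h⟩)

/-- Put the tangle `U` at the bottom. -/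
def post (U : Tangle m l) : TangleClass n m → TangleClass n l :=
  map (fun T => ⟨T.1 ++ U.1, T.2.append U.2⟩) fun _ _ h => h.append_right U.2

/-- Put the tangle `U` on top. -/
def pre (U : Tangle k n) : TangleClass n m → TangleClass k m :=
  map (fun T => ⟨U.1 ++ T.1, U.2.append T.2⟩) fun _ _ h => h.append_left U.2

/-- Put a crossing to the right. -/
def addRight (s : Bool) : TangleClass 2 2 → TangleClass 2 2 :=
  map (fun T => T.beside (.single s)) fun _ _ h => by
    have := (h.add_right 2).append (u := [(1, .cap)]) (n := 2)
      (v := shift 2 (Tangle.single s).1 ++ [(1, .cup)]) (m := 2)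
      (by simp [Typed, Piece.dom, Piece.cod])
      (((Tangle.single s).2.shift 2).append (by simp [Typed, Piece.dom, Piece.cod]))
    simpa [Tangle.beside] using this

/-- Put a crossing to the left. -/
def addLeft (s : Bool) : TangleClass 2 2 → TangleClass 2 2 :=
  map (fun T => (Tangle.single s).beside T) fun _ _ h => by
    have := (h.shift 2).append (u := [(1, .cap)] ++ (Tangle.single s).1)
      ((show Typed [(1, .cap)] 2 4 by simp [Typed, Piece.dom, Piece.cod]).append
        ((Tangle.single s).2.add_right 2))
      (v := [(1, .cup)]) (m := 2) (by simp [Typed, Piece.dom, Piece.cod])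
    simpa [Tangle.beside] using this

/-- A crossing of three strands. -/
def gen (i : Fin 2) (s : Bool) : Tangle 3 3 :=
  ⟨[(i, crossing s)], Tangle.typed_crossing s (by omega)⟩

theorem gen_inv (i : Fin 2) (s : Bool) : WordEquiv 3 3 ((gen i s).1 ++ (gen i !s).1) [] :=
  .of_local (localIsotopy_r2 s i) ((gen i s).2.append (gen i !s).2) rfl

theorem gen_pow (i : Fin 2) (s : Bool) : WordEquiv 3 3
    ((gen i s).1 ++ ((gen i s).1 ++ ((gen i s).1 ++ ((gen i s).1 ++ (gen i s).1)))) [] :=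
  (WordEquiv.of_five (localFiveMove_crossing s i) rfl
    ((gen i s).2.append ((gen i s).2.append ((gen i s).2.append
      ((gen i s).2.append (gen i s).2))))).symm

theorem gen_braid : ∀ i j : Fin 2, i ≠ j → WordEquiv 3 3
    ((gen i true).1 ++ ((gen j true).1 ++ (gen i true).1))
    ((gen j true).1 ++ ((gen i true).1 ++ (gen j true).1)) := by
  have h : WordEquiv 3 3 ((gen 0 true).1 ++ ((gen 1 true).1 ++ (gen 0 true).1))
      ((gen 1 true).1 ++ ((gen 0 true).1 ++ (gen 1 true).1)) :=
    .of_local (.r3 0) ((gen 0 true).2.append ((gen 1 true).2.append (gen 0 true).2))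
      ((gen 1 true).2.append ((gen 0 true).2.append (gen 1 true).2))
  intro i j hij
  fin_cases i <;> fin_cases j
  · exact absurd rfl hij
  · exact h
  · exact h.symm
  · exact absurd rfl hij

/-- The first permutation is a negative generator because bending reverses the sign of a crossing
added at the side. Its inverse and the second permutation are then both positive, and their braid
relation is the third Reidemeister move. -/
theorem braidPair_post {i j : Fin 2} (hij : i ≠ j) :
    BraidPair (X := TangleClass n 3) (post (gen i false)) (post (gen i true))
      (post (gen j true)) (post (gen j false)) where
  fst_inv := ind fun T => mk_eq_iff.2 <| by
    simpa only [List.append_assoc, List.append_nil, Bool.not_true, Bool.not_false] using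
      (gen_inv i true).append_left T.2
  inv_fst := ind fun T => mk_eq_iff.2 <| by
    simpa only [List.append_assoc, List.append_nil, Bool.not_true, Bool.not_false] using
      (gen_inv i false).append_left T.2
  snd_inv := ind fun T => mk_eq_iff.2 <| by
    simpa only [List.append_assoc, List.append_nil, Bool.not_true, Bool.not_false] using
      (gen_inv j false).append_left T.2
  inv_snd := ind fun T => mk_eq_iff.2 <| by
    simpa only [List.append_assoc, List.append_nil, Bool.not_true, Bool.not_false] using
      (gen_inv j true).append_left T.2
  fst_pow := ind fun T => mk_eq_iff.2 <| by
    simpa only [List.append_assoc, List.append_nil] using (gen_pow i false).append_left T.2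
  snd_pow := ind fun T => mk_eq_iff.2 <| by
    simpa only [List.append_assoc, List.append_nil] using (gen_pow j true).append_left T.2
  braid := ind fun T => mk_eq_iff.2 <| by
    simpa only [List.append_assoc, List.append_nil] using (gen_braid j i hij.symm).append_left T.2

theorem braidPair_pre {i j : Fin 2} (hij : i ≠ j) :
    BraidPair (X := TangleClass 3 n) (pre (gen i false)) (pre (gen i true))
      (pre (gen j true)) (pre (gen j false)) where
  fst_inv := ind fun T => mk_eq_iff.2 <| by
    simpa only [List.append_assoc, List.nil_append, Bool.not_true, Bool.not_false] using
      (gen_inv i false).append_right T.2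
  inv_fst := ind fun T => mk_eq_iff.2 <| by
    simpa only [List.append_assoc, List.nil_append, Bool.not_true, Bool.not_false] using
      (gen_inv i true).append_right T.2
  snd_inv := ind fun T => mk_eq_iff.2 <| by
    simpa only [List.append_assoc, List.nil_append, Bool.not_true, Bool.not_false] using
      (gen_inv j true).append_right T.2
  inv_snd := ind fun T => mk_eq_iff.2 <| by
    simpa only [List.append_assoc, List.nil_append, Bool.not_true, Bool.not_false] using
      (gen_inv j false).append_right T.2
  fst_pow := ind fun T => mk_eq_iff.2 <| by
    simpa only [List.append_assoc, List.nil_append] using (gen_pow i false).append_right T.2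
  snd_pow := ind fun T => mk_eq_iff.2 <| by
    simpa only [List.append_assoc, List.nil_append] using (gen_pow j true).append_right T.2
  braid := ind fun T => mk_eq_iff.2 <| by
    simpa only [List.append_assoc, List.nil_append] using
      (gen_braid j i hij.symm).append_right T.2

/-- Turn the upper right end down. -/
def bendRight : TangleClass 2 2 → TangleClass 1 3 :=
  map (fun T => ⟨[(1, .cap)] ++ T.1,
      (show Typed [(1, .cap)] 1 3 by simp [Typed, Piece.dom, Piece.cod]).append
        (T.2.add_right 1)⟩)
    fun _ _ h => (h.add_right 1).append_left (by simp [Typed, Piece.dom, Piece.cod])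

/-- Turn the upper left end down. -/
def bendLeft : TangleClass 2 2 → TangleClass 1 3 :=
  map (fun T => ⟨[(0, .cap)] ++ shift 1 T.1,
      (show Typed [(0, .cap)] 1 3 by simp [Typed, Piece.dom, Piece.cod]).append
        (T.2.shift 1)⟩)
    fun _ _ h => (h.shift 1).append_left (by simp [Typed, Piece.dom, Piece.cod])

/-- Turn the lower right end up. -/
def bendUp : TangleClass 2 2 → TangleClass 3 1 :=
  map (fun T => ⟨T.1 ++ [(1, .cup)],
      (T.2.add_right 1).append (by simp [Typed, Piece.dom, Piece.cod])⟩)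
    fun _ _ h => (h.add_right 1).append_right (by simp [Typed, Piece.dom, Piece.cod])

/-- Turning the end back up leaves a zigzag that can be straightened. -/
theorem bendRight_injective : Function.Injective bendRight := by
  refine ind fun S => ind fun T => fun h => mk_eq_iff.2 ?_
  have h := (mk_eq_iff.1 h).add_right 1 |>.append_right (v := [(2, .cup)]) (m := 2)
    (by simp [Typed, Piece.dom, Piece.cod])
  simp only [List.cons_append, List.nil_append] at h
  exact (WordEquiv.cap_cup_cancel_right S.2).symm.trans
    (h.trans (WordEquiv.cap_cup_cancel_right T.2))

theorem bendLeft_injective : Function.Injective bendLeft := by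
  refine ind fun S => ind fun T => fun h => mk_eq_iff.2 ?_
  have h := (mk_eq_iff.1 h).shift 1 |>.append_right (v := [(0, .cup)]) (m := 2)
    (by simp [Typed, Piece.dom, Piece.cod])
  simp only [shift_shift, shift_cons, List.cons_append, List.nil_append, add_zero,
    Nat.reduceAdd] at h
  exact (WordEquiv.cap_cup_cancel_left S.2).symm.trans
    (h.trans (WordEquiv.cap_cup_cancel_left T.2))

theorem bendUp_injective : Function.Injective bendUp := by
  refine ind fun S => ind fun T => fun h => mk_eq_iff.2 ?_
  have h := (mk_eq_iff.1 h).add_right 1 |>.append_left (u := [(2, .cap)]) (n := 2)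
    (by simp [Typed, Piece.dom, Piece.cod])
  exact (WordEquiv.cup_cap_cancel_right S.2).symm.trans
    (h.trans (WordEquiv.cup_cap_cancel_right T.2))

theorem bendRight_addRight (s : Bool) (x : TangleClass 2 2) :
    bendRight (addRight s x) = post (gen 1 !s) (bendRight x) := by
  revert x
  exact ind fun T => mk_eq_iff.2 (T.bend_beside s)

theorem bendRight_post (s : Bool) (x : TangleClass 2 2) :
    bendRight (post (.single s) x) = post (gen 0 s) (bendRight x) := by
  revert x
  exact ind fun T => congrArg mk (Subtype.ext (List.append_assoc _ _ _).symm)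

theorem bendLeft_addLeft (s : Bool) (x : TangleClass 2 2) :
    bendLeft (addLeft s x) = post (gen 0 !s) (bendLeft x) := by
  revert x
  exact ind fun T => mk_eq_iff.2 (T.bend_left_beside s)

theorem bendLeft_post (s : Bool) (x : TangleClass 2 2) :
    bendLeft (post (.single s) x) = post (gen 1 s) (bendLeft x) := by
  revert x
  refine ind fun T => congrArg mk (Subtype.ext ?_)
  change _ ++ shift 1 (T.1 ++ (Tangle.single s).1) = _ ++ shift 1 T.1 ++ _
  rw [shift_append, List.append_assoc]
  rfl

theorem bendUp_addRight (s : Bool) (x : TangleClass 2 2) :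
    bendUp (addRight s x) = pre (gen 1 !s) (bendUp x) := by
  revert x
  exact ind fun T => mk_eq_iff.2 (T.beside_bend s)

theorem bendUp_pre (s : Bool) (x : TangleClass 2 2) :
    bendUp (pre (.single s) x) = pre (gen 0 s) (bendUp x) := by
  revert x
  exact ind fun T => congrArg mk (Subtype.ext (List.append_assoc _ _ _))

/-- Sliding the crossing around the maximum puts it on the minimum as a kink. -/
theorem addRight_infty (s : Bool) : addRight s (mk .infty) = mk .infty := by
  refine mk_eq_iff.2 ?_
  have h1 := (WordEquiv.of_local (n := 2) (m := 4) (localIsotopy_slide_cap s 1)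
    ((show Typed [(1, .cap)] 2 4 by simp [Typed, Piece.dom, Piece.cod]).append
      (Tangle.typed_crossing s (by norm_num)))
    ((show Typed [(2, .cap)] 2 4 by simp [Typed, Piece.dom, Piece.cod]).append
      (Tangle.typed_crossing (!s) (by norm_num)))).append_right (v := [(1, .cup)]) (m := 2)
      (by simp [Typed, Piece.dom, Piece.cod])
  have h2 := (WordEquiv.of_local (n := 4) (m := 2) (localIsotopy_r1_cup (!s) 1)
    ((Tangle.typed_crossing (!s) (by norm_num)).append (by simp [Typed, Piece.dom, Piece.cod]))
    (by simp [Typed, Piece.dom, Piece.cod])).append_left (u := [(2, .cap)]) (n := 2)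
      (by simp [Typed, Piece.dom, Piece.cod])
  exact h1.trans (h2.trans (.of_local (.zigzag_left 1) (by simp [Typed, Piece.dom, Piece.cod]) rfl))

theorem addLeft_infty (s : Bool) : addLeft s (mk .infty) = mk .infty := by
  refine mk_eq_iff.2 ?_
  have h1 := (WordEquiv.of_local (n := 2) (m := 4) (localIsotopy_slide_cap (!s) 0)
    ((show Typed [(0, .cap)] 2 4 by simp [Typed, Piece.dom, Piece.cod]).append
      (Tangle.typed_crossing (!s) (by norm_num)))
    ((show Typed [(1, .cap)] 2 4 by simp [Typed, Piece.dom, Piece.cod]).append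
      (Tangle.typed_crossing (!!s) (by norm_num)))).symm.append_right (v := [(1, .cup)]) (m := 2)
      (by simp [Typed, Piece.dom, Piece.cod])
  have h2 := (WordEquiv.of_local (n := 4) (m := 2) (localIsotopy_r1_cup (!s) 1)
    ((Tangle.typed_crossing (!s) (by norm_num)).append (by simp [Typed, Piece.dom, Piece.cod]))
    (by simp [Typed, Piece.dom, Piece.cod])).append_left (u := [(0, .cap)]) (n := 2)
      (by simp [Typed, Piece.dom, Piece.cod])
  rw [Bool.not_not] at h1
  exact h1.trans (h2.trans
    (.of_local (.zigzag_right 0) (by simp [Typed, Piece.dom, Piece.cod]) rfl))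

theorem post_zero (s : Bool) : post (.single s) (mk .zero) = mk .zero :=
  mk_eq_iff.2 <| (WordEquiv.of_local (n := 0) (m := 2) (localIsotopy_r1_cap s 0)
    ((show Typed [(0, .cap)] 0 2 by simp [Typed, Piece.dom, Piece.cod]).append
      (Tangle.typed_crossing s (by norm_num))) (by simp [Typed, Piece.dom, Piece.cod])).append_left
    (u := [(0, .cup)]) (n := 2) (by simp [Typed, Piece.dom, Piece.cod])

theorem pre_zero (s : Bool) : pre (.single s) (mk .zero) = mk .zero :=
  mk_eq_iff.2 <| (WordEquiv.of_local (n := 2) (m := 0) (localIsotopy_r1_cup s 0)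
    ((Tangle.typed_crossing s (by norm_num)).append (by simp [Typed, Piece.dom, Piece.cod]))
    (by simp [Typed, Piece.dom, Piece.cod])).append_right
    (v := [(0, .cap)]) (m := 2) (by simp [Typed, Piece.dom, Piece.cod])

theorem post_infty (s : Bool) : post (.single s) (mk .infty) = mk (.single s) := rfl

theorem pre_infty (s : Bool) : pre (.single s) (mk .infty) = mk (.single s) := rfl

theorem addRight_zero (s : Bool) : addRight s (mk .zero) = mk (.single s) := by
  refine mk_eq_iff.2 ?_
  have hs := (Tangle.single s).2
  have h1 := (WordEquiv.of_local (n := 2) (m := 2) (.zigzag_left 0)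
    (by simp [Typed, Piece.dom, Piece.cod]) rfl).append_right
    (v := [(0, .cap)] ++ shift 2 (Tangle.single s).1 ++ [(1, .cup)]) (m := 2)
    (((show Typed [(0, .cap)] 2 4 by simp [Typed, Piece.dom, Piece.cod]).append
      (hs.shift 2)).append (by simp [Typed, Piece.dom, Piece.cod]))
  have h2 := (WordEquiv.exchange (u := [(0, .cap)]) (n := 0) (m := 2)
    (by simp [Typed, Piece.dom, Piece.cod]) hs).append_right (v := [(1, .cup)]) (m := 2)
    (by simp [Typed, Piece.dom, Piece.cod])
  have h3 := (WordEquiv.of_local (n := 2) (m := 2) (.zigzag_right 0)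
    (by simp [Typed, Piece.dom, Piece.cod]) rfl).append_left hs
  rw [shift_zero] at h2
  simp only [List.append_assoc, List.append_nil] at h1 h2 h3
  exact h1.trans (h2.trans h3)

theorem addLeft_zero (s : Bool) : addLeft s (mk .zero) = mk (.single s) := by
  refine mk_eq_iff.2 ?_
  have hs := (Tangle.single s).2
  have h1 := (WordEquiv.of_local (n := 2) (m := 2) (.zigzag_left 1)
    (by simp [Typed, Piece.dom, Piece.cod]) rfl).append_left
    (u := [(1, .cap)] ++ (Tangle.single s).1 ++ [(2, .cup)]) (n := 2)
    (((show Typed [(1, .cap)] 2 4 by simp [Typed, Piece.dom, Piece.cod]).append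
      (hs.add_right 2)).append (by simp [Typed, Piece.dom, Piece.cod]))
  exact h1.trans (WordEquiv.cap_cup_cancel_right hs)

theorem addRight_addLeft_comm (s r : Bool) (x : TangleClass 2 2) :
    addRight s (addLeft r x) = addLeft r (addRight s x) := by
  revert x
  exact ind fun T => mk_eq_iff.2 (Tangle.beside_assoc _ T _)

theorem post_pre_comm (s r : Bool) (x : TangleClass 2 2) :
    post (.single s) (pre (.single r) x) = pre (.single r) (post (.single s) x) := by
  revert x
  exact ind fun T => congrArg mk (Subtype.ext (List.append_assoc _ _ _))

/-! ### The common orbit and the classes of rational tangles -/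

/-- The class of a basic tangle, as an iterated twist of `[0]` or `[∞]`. -/
def orbit : Fin 12 → TangleClass 2 2 :=
  twistOrbit (addRight true) (addRight false) (post (.single true)) (post (.single false))
    (mk .zero) (mk .infty)

theorem twistPair_right_bottom : TwistPair (addRight true) (addRight false)
    (post (.single true)) (post (.single false)) (mk .zero) (mk .infty) where
  toBraidPair := (braidPair_post (i := 1) (j := 0) (by decide)).of_injective bendRight_injective
    (bendRight_addRight _) (bendRight_addRight _) (bendRight_post _) (bendRight_post _)
  fst_infty := addRight_infty _
  snd_zero := post_zero _
  one_eq := (post_infty _).trans (addRight_zero _).symm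
  negOne_eq := (post_infty _).trans (addRight_zero _).symm

theorem twistPair_left_bottom : TwistPair (addLeft true) (addLeft false)
    (post (.single true)) (post (.single false)) (mk .zero) (mk .infty) where
  toBraidPair := (braidPair_post (i := 0) (j := 1) (by decide)).of_injective bendLeft_injective
    (bendLeft_addLeft _) (bendLeft_addLeft _) (bendLeft_post _) (bendLeft_post _)
  fst_infty := addLeft_infty _
  snd_zero := post_zero _
  one_eq := (post_infty _).trans (addLeft_zero _).symm
  negOne_eq := (post_infty _).trans (addLeft_zero _).symm

theorem twistPair_right_top : TwistPair (addRight true) (addRight false)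
    (pre (.single true)) (pre (.single false)) (mk .zero) (mk .infty) where
  toBraidPair := (braidPair_pre (i := 1) (j := 0) (by decide)).of_injective bendUp_injective
    (bendUp_addRight _) (bendUp_addRight _) (bendUp_pre _) (bendUp_pre _)
  fst_infty := addRight_infty _
  snd_zero := pre_zero _
  one_eq := (pre_infty _).trans (addRight_zero _).symm
  negOne_eq := (pre_infty _).trans (addRight_zero _).symm

/-- Replaces a flype argument: adding a crossing on the left or on the right has the same effect on
the twelve classes. -/
theorem orbit_eq_left : twistOrbit (addLeft true) (addLeft false) (post (.single true))
    (post (.single false)) (mk .zero) (mk .infty) = orbit :=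
  twistPair_right_bottom.orbit_eq_of_fst_comm twistPair_left_bottom (addRight_addLeft_comm _ _)

theorem orbit_eq_top : twistOrbit (addRight true) (addRight false) (pre (.single true))
    (pre (.single false)) (mk .zero) (mk .infty) = orbit :=
  twistPair_right_bottom.orbit_eq_of_snd_comm twistPair_right_top (post_pre_comm _ _)

theorem mk_basic (i : Fin 12) : mk (Tangle.basic i) = orbit i := by
  have h1 : addRight true (mk .zero) = mk .one := addRight_zero true
  have h2 : addRight false (mk .zero) = mk .negOne := addRight_zero false
  fin_cases i
  · rfl
  · rfl
  · exact h2.symm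
  · exact h1.symm
  · exact (congrArg (addRight false) h2).symm
  · exact (congrArg (addRight true) h1).symm
  -- `[2/5]` is `[2]` with two crossings on top, while `orbit` twists at the bottom; likewise
  -- `[5/2]` and `[±3/2]` are built by additions on the left.
  · rw [← orbit_eq_top]
    exact (congrArg (fun x => pre (.single true) (pre (.single true) (addRight true x))) h1).symm
  · rw [← orbit_eq_left]
    exact mk_eq_iff.2 (Tangle.beside_assoc .one .one .half)
  · rw [← orbit_eq_left]
    rfl
  · rw [← orbit_eq_left]
    rfl
  · rfl
  · rfl

theorem addRight_mem_range (s : Bool) {x : TangleClass 2 2} (hx : x ∈ Set.range orbit) :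
    addRight s x ∈ Set.range orbit := by
  have := twistPair_right_bottom.fst_mem_range hx
  cases s
  · exact this.2
  · exact this.1

theorem post_mem_range (s : Bool) {x : TangleClass 2 2} (hx : x ∈ Set.range orbit) :
    post (.single s) x ∈ Set.range orbit := by
  have := twistPair_right_bottom.snd_mem_range hx
  cases s
  · exact this.2
  · exact this.1

theorem addLeft_mem_range (s : Bool) {x : TangleClass 2 2} (hx : x ∈ Set.range orbit) :
    addLeft s x ∈ Set.range orbit := by
  rw [← orbit_eq_left] at hx ⊢
  have := twistPair_left_bottom.fst_mem_range hx
  cases s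
  · exact this.2
  · exact this.1

theorem pre_mem_range (s : Bool) {x : TangleClass 2 2} (hx : x ∈ Set.range orbit) :
    pre (.single s) x ∈ Set.range orbit := by
  rw [← orbit_eq_top] at hx ⊢
  have := twistPair_right_top.snd_mem_range hx
  cases s
  · exact this.2
  · exact this.1

theorem mk_mem_range_of_rationalDiagram {D : Tangle 2 2} (hD : D.RationalDiagram) :
    mk D ∈ Set.range orbit := by
  have hcases : ∀ {c : Tangle 2 2}, c = .one ∨ c = .negOne → ∃ s, c = .single s := by
    rintro c (rfl | rfl)
    exacts [⟨true, rfl⟩, ⟨false, rfl⟩]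
  induction hD with
  | zero => exact ⟨1, rfl⟩
  | infty => exact ⟨0, rfl⟩
  | right _ hc ih =>
    obtain ⟨s, rfl⟩ := hcases hc
    exact addRight_mem_range s ih
  | left _ hc ih =>
    obtain ⟨s, rfl⟩ := hcases hc
    exact addLeft_mem_range s ih
  | bottom _ hc ih =>
    obtain ⟨s, rfl⟩ := hcases hc
    exact post_mem_range s ih
  | top _ hc ih =>
    obtain ⟨s, rfl⟩ := hcases hc
    exact pre_mem_range s ih

end TangleClass

theorem Tangle.Isotopic.fiveMoveEquiv {n m : ℕ} {S T : Tangle n m} (h : S.Isotopic T) :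
    S.FiveMoveEquiv T :=
  Relation.EqvGen.mono (fun _ _ => Or.inl) _ _ h

theorem lemma2p10 :
    (∀ T : Tangle 2 2, T.IsRational → ∃ i : Fin 12, T.FiveMoveEquiv (Tangle.basic i)) ∧
      (∀ i j : Fin 12, i ≠ j → ¬ (Tangle.basic i).FiveMoveEquiv (Tangle.basic j)) := by
  refine ⟨?_, fun i j hij => Tangle.not_fiveMoveEquiv_basic hij⟩
  rintro T ⟨D, hD, hTD⟩
  obtain ⟨i, hi⟩ := TangleClass.mk_mem_range_of_rationalDiagram hD
  rw [← TangleClass.mk_basic] at hi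
  exact ⟨i, .trans _ _ _ hTD.fiveMoveEquiv (.symm _ _ (Quotient.exact hi))⟩
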